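/- Let $B$ be a smooth irreducible affine curve over $\mathbb{C}$ and let $\pi:\mathcal{E}\to B$ be an elliptic scheme given by a Weierstrass equation with coefficients in $\mathbb{C}[B]$ whose discriminant is nowhere zero on $B$, with zero section $O$. Let $\sigma: B\to\mathcal{E}$ be a section which is not torsion, i.e. $n\sigma\neq O$ for every integer $n>0$, and let $b\in B(\mathbb{C})$ be a torsion point of $\sigma$, i.e. $n\sigma(b)=0$ in the fibre $\mathcal{E}_b$ for some integer $n>0$. For $n>0$ with $n\sigma(b)=0$, let $m_\sigma(b)$ be the local intersection multiplicity at $\sigma(b)$, on the surface $\mathcal{E}$, of the curve $\sigma(B)$ with the torsion divisor $\mathcal{E}[n]$ (the inverse image of $O$ under multiplication by $n$), that is, the length of $\mathcal{O}_{\mathcal{E},\sigma(b)}/(I_{\sigma(B)}+I_{\mathcal{E}[n]})$. On a neighbourhood $D$ of $b$ in $B(\mathbb{C})$ which is the domain of a holomorphic coordinate, with a holomorphic choice of periods $\rho_1,\rho_2$ of the fibres, a determination of the Betti map of $\sigma$ is a real analytic map $\beta_\sigma=(\beta_1,\beta_2):D\to\mathbb{R}^2$ such that $\beta_1(u)\rho_1(u)+\beta_2(u)\rho_2(u)$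 is an elliptic logarithm of $\sigma(u)$ for every $u\in D$. Its multiplicity at $b$ is the least $k\ge 1$ such that some partial derivative of order $k$ of $\beta_\sigma$ (with respect to a real coordinate system given by the real and imaginary parts of a holomorphic coordinate) does not vanish at $b$. Then there is a natural number $m$, depending only on $\sigma$ and $b$, such that $m_\sigma(b)=m$ for every $n>0$ with $n\sigma(b)=0$, and such that the multiplicity at $b$ of every determination of the Betti map of $\sigma$, for every choice of holomorphic coordinate at $b$ and of holomorphic periods, exists and equals $m$. In particular $m_\sigma(b)$ is finite and does not depend on $n$. -/

import Mathlib

open scoped Polynomial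

noncomputable section

namespace EllipticScheme

/-! ## Points in homogeneous coordinates -/

/-- Homogeneous coordinates in the projective plane of a point of a Weierstrass curve over a
field: `[0 : 1 : 0]` for the origin and `[x : y : 1]` for an affine point `(x, y)`. -/
def coords {F : Type*} [Field F] {W : WeierstrassCurve F} : W.toAffine.Point → Fin 3 → F
  | .zero => ![0, 1, 0]
  | .some x y _ => ![x, y, 1]

section Algebraic

variable {R : Type*} [CommRing R]

/-- The fibre over the complex point `b` of the Weierstrass scheme `W` over `Spec R`. -/
abbrev fibre [Algebra ℂ R] (W : WeierstrassCurve R) (b : R →ₐ[ℂ] ℂ) : WeierstrassCurve ℂ :=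
  W.map (b : R →+* ℂ)

/-- `IsValueAt W σ b P` says that the section `σ`, given by its generic point, takes the value `P`
at the complex point `b`: near `b` the section has regular homogeneous coordinates `v` without
common zero at `b`, and the values of `v` at `b` are homogeneous coordinates of `P`. -/
def IsValueAt [Algebra ℂ R] {K : Type*} [Field K] [Algebra R K] (W : WeierstrassCurve R)
    (σ : (W.map (algebraMap R K)).toAffine.Point) (b : R →ₐ[ℂ] ℂ)
    (P : (fibre W b).toAffine.Point) : Prop :=
  ∃ v : Fin 3 → R,
    (∃ c : K, c ≠ 0 ∧ ∀ i, algebraMap R K (v i) = c * coords σ i) ∧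
    (∃ c : ℂ, c ≠ 0 ∧ ∀ i, b (v i) = c * coords P i)

/-! ## The local ring of the elliptic surface -/

/-- The function field of the surface defined by `W` over `Spec R`, that is, the fraction field of
`R[x, y] / (W(x, y))`. -/
abbrev SurfaceField (W : WeierstrassCurve R) : Type _ :=
  W.toAffine.FunctionField

section Generic

variable [IsDomain R] (W : WeierstrassCurve R)

/-- The inclusion of the functions on the base into the function field of the surface. -/
def baseToField : R →+* SurfaceField W :=
  (algebraMap W.toAffine.CoordinateRing (SurfaceField W)).comp
    (algebraMap R W.toAffine.CoordinateRing)

/-- The coordinate function `x` on the surface. -/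
def genericX : SurfaceField W :=
  algebraMap W.toAffine.CoordinateRing (SurfaceField W)
    (WeierstrassCurve.Affine.CoordinateRing.mk W.toAffine (Polynomial.C Polynomial.X))

/-- The coordinate function `y` on the surface. -/
def genericY : SurfaceField W :=
  algebraMap W.toAffine.CoordinateRing (SurfaceField W)
    (WeierstrassCurve.Affine.CoordinateRing.mk W.toAffine Polynomial.X)

lemma generic_equation :
    (W.map (baseToField W)).toAffine.Equation (genericX W) (genericY W) := by
  have h : ((algebraMap W.toAffine.CoordinateRing (SurfaceField W)).comp
      (WeierstrassCurve.Affine.CoordinateRing.mk W.toAffine)) W.toAffine.polynomial = 0 := by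
    rw [RingHom.comp_apply, AdjoinRoot.mk_self, RingHom.map_zero]
  have key : ∀ {F : Type _} [Field F] (ψ : R[X][X] →+* F) (f : R →+* F),
      (∀ r, f r = ψ (Polynomial.C (Polynomial.C r))) → ψ W.toAffine.polynomial = 0 →
      (W.map f).toAffine.Equation (ψ (Polynomial.C Polynomial.X)) (ψ Polynomial.X) := by
    intro F _ ψ f hf h
    rw [WeierstrassCurve.Affine.equation_iff]
    simp only [WeierstrassCurve.map_a₁, WeierstrassCurve.map_a₂, WeierstrassCurve.map_a₃,
      WeierstrassCurve.map_a₄, WeierstrassCurve.map_a₆, hf]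
    simp only [WeierstrassCurve.Affine.polynomial, map_add, map_sub, map_mul, map_pow] at h
    linear_combination h
  exact key _ _ (fun _ => rfl) h

/-- The generic point `(x, y)` of the surface, as a point of the elliptic curve over the function
field of the surface. -/
def genericPoint [W.IsElliptic] : (W.map (baseToField W)).toAffine.Point :=
  .some (genericX W) (genericY W)
    (WeierstrassCurve.Affine.equation_iff_nonsingular.mp (generic_equation W))

variable [Algebra ℂ R] [W.IsElliptic] {b : R →ₐ[ℂ] ℂ} (P : (fibre W b).toAffine.Point)

/-- `IsGerm W P F G f` says that the rational function `f` on the surface is the quotient `F / G`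
of two forms of the same degree in `X, Y, Z` with coefficients in `R`, the denominator of which
does not vanish at the point `P` of the fibre over `b`. -/
def IsGerm (F G : MvPolynomial (Fin 3) R) (f : SurfaceField W) : Prop :=
  (∃ d : ℕ, F.IsHomogeneous d ∧ G.IsHomogeneous d) ∧
    MvPolynomial.eval₂ (b : R →+* ℂ) (coords P) G ≠ 0 ∧
    MvPolynomial.eval₂ (baseToField W) (coords (genericPoint W)) G ≠ 0 ∧
    f = MvPolynomial.eval₂ (baseToField W) (coords (genericPoint W)) F /
      MvPolynomial.eval₂ (baseToField W) (coords (genericPoint W)) G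

variable {W P}

lemma IsGerm.add {F G F' G' : MvPolynomial (Fin 3) R} {f f' : SurfaceField W}
    (h : IsGerm W P F G f) (h' : IsGerm W P F' G' f') :
    IsGerm W P (F * G' + F' * G) (G * G') (f + f') := by
  obtain ⟨⟨d, hF, hG⟩, hP, hη, rfl⟩ := h
  obtain ⟨⟨d', hF', hG'⟩, hP', hη', rfl⟩ := h'
  refine ⟨⟨d + d', (hF.mul hG').add ?_, hG.mul hG'⟩, ?_, ?_, ?_⟩
  · rw [add_comm d d']
    exact hF'.mul hG
  · rw [MvPolynomial.eval₂_mul]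
    exact mul_ne_zero hP hP'
  · rw [MvPolynomial.eval₂_mul]
    exact mul_ne_zero hη hη'
  · simp only [MvPolynomial.eval₂_mul, MvPolynomial.eval₂_add]
    rw [div_add_div _ _ hη hη']
    ring

lemma IsGerm.mul {F G F' G' : MvPolynomial (Fin 3) R} {f f' : SurfaceField W}
    (h : IsGerm W P F G f) (h' : IsGerm W P F' G' f') :
    IsGerm W P (F * F') (G * G') (f * f') := by
  obtain ⟨⟨d, hF, hG⟩, hP, hη, rfl⟩ := h
  obtain ⟨⟨d', hF', hG'⟩, hP', hη', rfl⟩ := h'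
  refine ⟨⟨d + d', hF.mul hF', hG.mul hG'⟩, ?_, ?_, ?_⟩
  · rw [MvPolynomial.eval₂_mul]
    exact mul_ne_zero hP hP'
  · rw [MvPolynomial.eval₂_mul]
    exact mul_ne_zero hη hη'
  · simp only [MvPolynomial.eval₂_mul]
    rw [div_mul_div_comm]

lemma IsGerm.neg {F G : MvPolynomial (Fin 3) R} {f : SurfaceField W}
    (h : IsGerm W P F G f) : IsGerm W P (-F) G (-f) := by
  obtain ⟨⟨d, hF, hG⟩, hP, hη, rfl⟩ := h
  refine ⟨⟨d, hF.neg, hG⟩, hP, hη, ?_⟩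
  have : MvPolynomial.eval₂ (baseToField W) (coords (genericPoint W)) (-F) =
      -MvPolynomial.eval₂ (baseToField W) (coords (genericPoint W)) F :=
    (MvPolynomial.eval₂Hom (baseToField W) (coords (genericPoint W))).map_neg F
  rw [this, neg_div]

lemma isGerm_C (r : R) : IsGerm W P (MvPolynomial.C r) 1 (baseToField W r) := by
  refine ⟨⟨0, MvPolynomial.isHomogeneous_C _ _, MvPolynomial.isHomogeneous_one _ _⟩, ?_, ?_, ?_⟩ <;>
  simp

variable (W P)

/-- The local ring of the surface at the point `P` of the fibre over `b`, as a subring of the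
function field of the surface: the rational functions that are regular at `P`. -/
def localRing : Subring (SurfaceField W) where
  carrier := {f | ∃ F G, IsGerm W P F G f}
  mul_mem' := fun ⟨_, _, h⟩ ⟨_, _, h'⟩ => ⟨_, _, h.mul h'⟩
  one_mem' := ⟨_, _, by simpa using isGerm_C (W := W) (P := P) 1⟩
  add_mem' := fun ⟨_, _, h⟩ ⟨_, _, h'⟩ => ⟨_, _, h.add h'⟩
  zero_mem' := ⟨_, _, by simpa using isGerm_C (W := W) (P := P) 0⟩
  neg_mem' := fun ⟨_, _, h⟩ => ⟨_, _, h.neg⟩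

/-! ## Local intersection multiplicity with the torsion divisor -/

/-- The ideal, in the local ring at `P`, of the curve which is the image of the section `σ`: it is
generated by the regular functions at `P` which vanish along `σ`. -/
def sectionIdeal {K : Type*} [Field K] [Algebra R K]
    (σ : (W.map (algebraMap R K)).toAffine.Point) : Ideal (localRing W P) :=
  Ideal.span {f | ∃ F G, IsGerm W P F G f ∧
    MvPolynomial.eval₂ (algebraMap R K) (coords σ) F = 0}

open Classical in
/-- The ideal, in the local ring at an `n`-torsion point `P`, of the torsion divisor `E[n]`, the
inverse image of the zero section under multiplication by `n`. In the chart `Y ≠ 0` the zero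
section is defined by `X / Y = Z / Y = 0`; the ideal is generated by the pullbacks of these two
functions under multiplication by `n`, that is, by their values at the `n`-th multiple of the
generic point. -/
def torsionIdeal (n : ℕ) : Ideal (localRing W P) :=
  Ideal.span {f |
    (f : SurfaceField W) = coords (n • genericPoint W) 0 / coords (n • genericPoint W) 1 ∨
    (f : SurfaceField W) = coords (n • genericPoint W) 2 / coords (n • genericPoint W) 1}

/-- The local intersection multiplicity at `P` of the image of `σ` with the torsion divisor
`E[n]`: the length of the quotient of the local ring of the surface at `P` by the sum of the ideals
of the two curves. -/
def torsionIntersection {K : Type*} [Field K] [Algebra R K]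
    (σ : (W.map (algebraMap R K)).toAffine.Point) (n : ℕ) : ℕ∞ :=
  Module.length (localRing W P) (localRing W P ⧸ (sectionIdeal W P σ ⊔ torsionIdeal W P n))

end Generic

end Algebraic

/-! ## The analytic structure: elliptic exponential, periods, Betti map -/

section Analytic

/-- `L` is a pair of periods of the elliptic curve `W`, that is, a basis of the period lattice of
its invariant differential `dx / (2y + a₁x + a₃)`. -/
def IsPeriodPairOf (W : WeierstrassCurve ℂ) (L : PeriodPair) : Prop :=
  L.g₂ = W.c₄ / 12 ∧ L.g₃ = W.c₆ / 216

lemma exp_equation {W : WeierstrassCurve ℂ} {L : PeriodPair} (hL : IsPeriodPairOf W L) {z : ℂ}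
    (hz : z ∉ L.lattice) :
    W.toAffine.Equation (L.weierstrassP z - W.b₂ / 12)
      ((L.derivWeierstrassP z - W.a₁ * (L.weierstrassP z - W.b₂ / 12) - W.a₃) / 2) := by
  have h := L.derivWeierstrassP_sq z hz
  rw [hL.1, hL.2] at h
  rw [WeierstrassCurve.Affine.equation_iff]
  simp only [WeierstrassCurve.c₄, WeierstrassCurve.c₆, WeierstrassCurve.b₂, WeierstrassCurve.b₄,
    WeierstrassCurve.b₆] at h ⊢
  linear_combination h / 4

open Classical in
/-- The elliptic exponential `ℂ → W(ℂ)` with kernel the period lattice, given by the Weierstrass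
functions `℘` and `℘'`. The (multivalued) elliptic logarithm is its inverse. -/
def ellipticExp (W : WeierstrassCurve ℂ) [W.IsElliptic] (L : PeriodPair)
    (hL : IsPeriodPairOf W L) (z : ℂ) : W.toAffine.Point :=
  if hz : z ∈ L.lattice then 0 else
    .some (L.weierstrassP z - W.b₂ / 12)
      ((L.derivWeierstrassP z - W.a₁ * (L.weierstrassP z - W.b₂ / 12) - W.a₃) / 2)
      (WeierstrassCurve.Affine.equation_iff_nonsingular.mp (exp_equation hL hz))

variable {R : Type*} [CommRing R] [Algebra ℂ R]

/-- A holomorphic local coordinate at the complex point `b` of the smooth curve `Spec R`, given by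
the inverse chart `φ`, an injective holomorphic immersion of an open neighbourhood `U` of `0` in
`ℂ` into the complex points of the curve, with `φ 0 = b`. -/
structure LocalCoordinate (b : R →ₐ[ℂ] ℂ) where
  U : Set ℂ
  isOpen : IsOpen U
  zero_mem : (0 : ℂ) ∈ U
  φ : ℂ → (R →ₐ[ℂ] ℂ)
  map_zero : φ 0 = b
  holomorphic : ∀ f : R, DifferentiableOn ℂ (fun u => φ u f) U
  immersion : ∀ u ∈ U, ∃ f : R, deriv (fun u => φ u f) u ≠ 0
  injOn : Set.InjOn φ U

/-- A holomorphic choice of periods for the fibres over the domain of a local coordinate. -/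
structure PeriodChoice (W : WeierstrassCurve R) {b : R →ₐ[ℂ] ℂ} (D : LocalCoordinate b) where
  L : ℂ → PeriodPair
  isPeriodPair : ∀ u ∈ D.U, IsPeriodPairOf (fibre W (D.φ u)) (L u)
  holomorphic₁ : DifferentiableOn ℂ (fun u => (L u).ω₁) D.U
  holomorphic₂ : DifferentiableOn ℂ (fun u => (L u).ω₂) D.U

/-- `IsBettiMap W σ ρ β` says that `β`, written in the local coordinate, is a determination of the
Betti map of the section `σ`: a real analytic map to `ℝ²` such that `β₁ ρ₁ + β₂ ρ₂` is an elliptic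
logarithm of the value of `σ` at every point of the domain. -/
def IsBettiMap (W : WeierstrassCurve R) [W.IsElliptic] {K : Type*} [Field K] [Algebra R K]
    (σ : (W.map (algebraMap R K)).toAffine.Point) {b : R →ₐ[ℂ] ℂ} {D : LocalCoordinate b}
    (ρ : PeriodChoice W D) (β : ℂ → ℝ × ℝ) : Prop :=
  AnalyticOnNhd ℝ β D.U ∧
    ∀ (u : ℂ) (hu : u ∈ D.U), IsValueAt W σ (D.φ u)
      (ellipticExp (fibre W (D.φ u)) (ρ.L u) (ρ.isPeriodPair u hu)
        ((β u).1 * (ρ.L u).ω₁ + (β u).2 * (ρ.L u).ω₂))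

/-- `m` is the multiplicity of `β` at `u`: the minimal order `k ≥ 1` such that some partial
derivative of order `k` of `β` does not vanish at `u`. (The `k`-th iterated Fréchet derivative is
zero exactly when all partial derivatives of order `k` vanish.) -/
def IsMultiplicity (β : ℂ → ℝ × ℝ) (u : ℂ) (m : ℕ) : Prop :=
  IsLeast {k : ℕ | 1 ≤ k ∧ iteratedFDeriv ℝ k β u ≠ 0} m

end Analytic

end EllipticScheme

end

/-!
Fix `n > 0` with `n σ(b) = 0`. In the chart `Y ≠ 0` of the plane the zero section is cut out by
`z = X / Y` and `w = Z / Y`, and near it the Weierstrass equation makes `w` a multiple of `z ^ 3`.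
Restricting functions to the curve `σ(B)` identifies the quotient of the local ring of the surface
by the ideal of the curve with the local ring of `B` at `b`, a discrete valuation ring, so the
intersection multiplicity with `E[n]` is the order of vanishing at `b` of `z(n σ)`
(`exists_torsionIntersection_eq_ord`). This needs that multiples of a point commute with
specialisation over a local ring (`Specializes.nsmul`). Away from the origin the usual chord and
duplication formulas specialise; at the origin the chord construction is carried out in the
coordinates `(z, w)`, where it shows moreover that `z(k A) = k z(A) + O(z(A) ^ 2)`. The integer `k`
being a unit, the order of `z(n σ)` does not change when `n` is replaced by a multiple, hence does
not depend on `n` (`ord_eq_ord`). Call it `m`; the outcome of the algebra is `exists_multiplicity`.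

On the analytic side, the addition theorem for `℘` makes the elliptic exponential a homomorphism
(`ellipticExp_add`). If `β` is a determination of the Betti map, `n β(b)` is a vector of integers,
so that `n σ(u)` is the exponential of `S(u) = δ₁(u) ρ₁(u) + δ₂(u) ρ₂(u)`, where
`δ(u) = n (β(u) - β(b))` is small. The function `z = X / Y` of the exponential of `s` is
`-s + O(s ^ 2)`, uniformly over the fibres near `b` (`exists_norm_coords_div_add_le`), and
`|S(u)|` is comparable to `|δ(u)|`, because the period lattices stay uniformly nondegenerate
(`PeriodPair.HasGap`). Hence `|β(u) - β(b)|` is comparable to `|z(n σ(u))|`, that is, to `|u| ^ m`.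
For a real analytic map this exact order of growth is the least order of a nonzero derivative
(`isLeast_iteratedFDeriv_ne_zero`).
-/

noncomputable section

/-! ### Representatives of points and their specialisation -/

namespace EllipticScheme

open WeierstrassCurve
open scoped WeierstrassCurve.Projective

/-- The vector `v` is a system of homogeneous coordinates of the point `A`. -/
def IsRep {F : Type*} [Field F] {W : WeierstrassCurve F} (v : Fin 3 → F)
    (A : W.toAffine.Point) : Prop :=
  ∃ c : F, c ≠ 0 ∧ ∀ i, v i = c * coords A i

section IsRep

variable {F : Type*} [Field F] {W : WeierstrassCurve F} {v w : Fin 3 → F} {A B : W.toAffine.Point}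

/-- The vector `coords A` corresponds to `A` under Mathlib's dictionary between projective vectors
and affine points. -/
lemma toAffine_coords (A : W.toAffine.Point) :
    W.toProjective.Nonsingular (coords A) ∧
      Projective.Point.toAffine W.toProjective (coords A) = A := by
  rcases A with _ | ⟨x, y, h⟩
  · exact ⟨Projective.nonsingular_zero, Projective.Point.toAffine_zero⟩
  · have h' : W.toProjective.Nonsingular ![x, y, 1] := (Projective.nonsingular_some x y).mpr h
    exact ⟨h', Projective.Point.toAffine_some h'⟩

lemma coords_toAffine_of_nonsingular (hv : W.toProjective.Nonsingular v) :
    IsRep v (Projective.Point.toAffine W.toProjective v) := by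
  by_cases hz : v 2 = 0
  · rw [Projective.Point.toAffine_of_Z_eq_zero hz]
    refine ⟨v 1, (Projective.isUnit_Y_of_Z_eq_zero hv hz).ne_zero, fun i => ?_⟩
    have hx : v 0 = 0 := Projective.X_eq_zero_of_Z_eq_zero hv.1 hz
    change v i = v 1 * ![0, 1, 0] i
    fin_cases i <;> simp [hx, hz]
  · rw [Projective.Point.toAffine_of_Z_ne_zero hv hz]
    refine ⟨v 2, hz, fun i => ?_⟩
    change v i = v 2 * ![v 0 / v 2, v 1 / v 2, 1] i
    fin_cases i <;> simp [mul_div_cancel₀ _ hz]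

lemma isRep_iff :
    IsRep v A ↔ W.toProjective.Nonsingular v ∧ Projective.Point.toAffine W.toProjective v = A := by
  constructor
  · rintro ⟨c, hc, h⟩
    obtain rfl : v = c • coords A := funext h
    obtain ⟨h₁, h₂⟩ := toAffine_coords A
    exact ⟨(Projective.nonsingular_smul _ hc.isUnit).mpr h₁, by
      rw [Projective.Point.toAffine_smul _ hc.isUnit, h₂]⟩
  · rintro ⟨h, rfl⟩
    exact coords_toAffine_of_nonsingular h

lemma IsRep.eq (hA : IsRep v A) (hB : IsRep v B) : A = B :=
  (isRep_iff.mp hA).2.symm.trans (isRep_iff.mp hB).2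

lemma IsRep.smul (hA : IsRep v A) {c : F} (hc : c ≠ 0) : IsRep (c • v) A := by
  obtain ⟨d, hd, h⟩ := hA
  exact ⟨c * d, mul_ne_zero hc hd, fun i => by rw [Pi.smul_apply, smul_eq_mul, h, mul_assoc]⟩

lemma IsRep.of_smul {c : F} (hA : IsRep (c • v) A) (hc : c ≠ 0) : IsRep v A := by
  simpa [smul_smul, inv_mul_cancel₀ hc] using hA.smul (inv_ne_zero hc)

lemma IsRep.cross (hv : IsRep v A) (hw : IsRep w A) (i j : Fin 3) : v i * w j = v j * w i := by
  obtain ⟨c, hc, h⟩ := hv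
  obtain ⟨d, hd, h'⟩ := hw
  rw [h, h', h, h']
  ring

/-- Two vectors with proportional coordinates represent the same point. -/
lemma IsRep.eq_of_cross (hv : IsRep v A) (hw : IsRep w B) (h : ∀ i j, v i * w j = v j * w i) :
    A = B := by
  obtain ⟨j, hj⟩ : ∃ j, w j ≠ 0 := by
    by_contra! hcon
    have h1 := (isRep_iff.mp hw).1
    have : w = 0 := funext hcon
    rw [this, Projective.nonsingular_of_Z_eq_zero rfl] at h1
    simp at h1
  have hvj : v j ≠ 0 := by
    intro hvj
    have h0 : ∀ i, v i = 0 := fun i => by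
      have := h i j
      rw [hvj, zero_mul] at this
      exact (mul_eq_zero.mp this).resolve_right hj
    have h1 := (isRep_iff.mp hv).1
    have : v = 0 := funext h0
    rw [this, Projective.nonsingular_of_Z_eq_zero rfl] at h1
    simp at h1
  have : v = (v j / w j) • w := by
    funext i
    rw [Pi.smul_apply, smul_eq_mul, div_mul_eq_mul_div, ← h i j]
    field_simp
  rw [this] at hv
  exact (hv.of_smul (div_ne_zero hvj hj)).eq hw

lemma IsRep.equation (hv : IsRep v A) : W.toProjective.Equation v := (isRep_iff.mp hv).1.1

variable [DecidableEq F]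

lemma IsRep.addXYZ (hv : IsRep v A) (hw : IsRep w B) (hAB : A ≠ B) :
    IsRep (W.toProjective.addXYZ v w) (A + B) := by
  have hne : ¬ v ≈ w := fun h => hAB <| by
    rw [← (isRep_iff.mp hv).2, ← (isRep_iff.mp hw).2, Projective.Point.toAffine_of_equiv h]
  rw [← Projective.add_of_not_equiv hne, isRep_iff]
  have h1 := isRep_iff.mp hv
  have h2 := isRep_iff.mp hw
  exact ⟨Projective.nonsingular_add h1.1 h2.1, by
    rw [Projective.Point.toAffine_add h1.1 h2.1, h1.2, h2.2]⟩

lemma IsRep.dblXYZ (hv : IsRep v A) : IsRep (W.toProjective.dblXYZ v) (A + A) := by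
  rw [← Projective.add_self, isRep_iff]
  have h1 := isRep_iff.mp hv
  exact ⟨Projective.nonsingular_add h1.1 h1.1, by
    rw [Projective.Point.toAffine_add h1.1 h1.1, h1.2]⟩

end IsRep

/-- Given a ring `O` with maps `f` to a field `F` and `g` to a field `k`, the point `A` over `F`
specialises to the point `a` over `k`: some vector over `O` represents `A` over `F` and `a`
over `k`. -/
def Specializes {O F k : Type*} [CommRing O] [Field F] [Field k] (f : O →+* F) (g : O →+* k)
    {W : WeierstrassCurve F} {W' : WeierstrassCurve k} (A : W.toAffine.Point)
    (a : W'.toAffine.Point) : Prop :=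
  ∃ v : Fin 3 → O, IsRep (f ∘ v) A ∧ IsRep (g ∘ v) a

section Specializes

variable {O F k : Type*} [CommRing O] [Field F] [Field k] {f : O →+* F} {g : O →+* k}
  {W₀ : WeierstrassCurve O} {W : WeierstrassCurve F} {W' : WeierstrassCurve k}
  {A B : W.toAffine.Point} {a b : W'.toAffine.Point}

lemma Specializes.unique (hf : Function.Injective f) (h : Specializes f g A a)
    (h' : Specializes f g A b) : a = b := by
  obtain ⟨v, hv, hv'⟩ := h
  obtain ⟨w, hw, hw'⟩ := h'
  refine hv'.eq_of_cross hw' fun i j => ?_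
  have : v i * w j = v j * w i := hf <| by simpa using hv.cross hw i j
  simpa using congrArg g this

/-- A vector over `O` representing `A`, whose image over `k` is not zero, represents over `k` the
point to which `A` specialises. -/
lemma Specializes.isRep_of_isRep (hf : Function.Injective f) (h : Specializes f g A a)
    {v : Fin 3 → O} (hv : IsRep (f ∘ v) A) {j : Fin 3} (hj : g (v j) ≠ 0) : IsRep (g ∘ v) a := by
  obtain ⟨w, hw, d, hd, hw'⟩ := h
  have hcross : ∀ i, g (v i) * g (w j) = g (v j) * g (w i) := fun i => by
    have : v i * w j = v j * w i := hf <| by simpa using hv.cross hw i j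
    simpa using congrArg g this
  have hw'' : ∀ i, g (w i) = d * coords a i := hw'
  have hwj : g (w j) ≠ 0 := by
    intro h0
    have h1 : ∀ i, coords a i = 0 := fun i => by
      have := hcross i
      rw [h0, mul_zero, hw''] at this
      exact (mul_eq_zero.mp ((mul_eq_zero.mp this.symm).resolve_left hj)).resolve_left hd
    have h2 := (toAffine_coords a).1
    rw [show coords a = 0 from funext h1, Projective.nonsingular_of_Z_eq_zero rfl] at h2
    simp at h2
  refine ⟨g (v j) / g (w j) * d, mul_ne_zero (div_ne_zero hj hwj) hd, fun i => ?_⟩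
  rw [mul_assoc, ← hw'', div_mul_eq_mul_div, ← hcross i]
  exact (mul_div_cancel_right₀ _ hwj).symm

lemma isRep_map_zero {W : WeierstrassCurve F} (f : O →+* F) :
    IsRep (f ∘ ![0, 1, 0]) (0 : W.toAffine.Point) := by
  refine ⟨1, one_ne_zero, fun i => ?_⟩
  change f (![0, 1, 0] i) = 1 * ![0, 1, 0] i
  fin_cases i <;> simp

lemma specializes_zero : Specializes f g (0 : W.toAffine.Point) (0 : W'.toAffine.Point) :=
  ⟨![0, 1, 0], isRep_map_zero f, isRep_map_zero g⟩

variable [DecidableEq F] [DecidableEq k]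

/-- The chord formula specialises when the two values differ. -/
lemma Specializes.add_of_ne (hf : Function.Injective f) (hW : W₀.map f = W) (hW' : W₀.map g = W')
    (hA : Specializes f g A a) (hB : Specializes f g B b) (hab : a ≠ b) :
    Specializes f g (A + B) (a + b) := by
  subst hW hW'
  have hAB : A ≠ B := by
    rintro rfl
    exact hab (hA.unique hf hB)
  obtain ⟨v, hv, hv'⟩ := hA
  obtain ⟨w, hw, hw'⟩ := hB
  refine ⟨W₀.toProjective.addXYZ v w, ?_, ?_⟩
  · simpa only [← Projective.map_addXYZ] using hv.addXYZ hw hAB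
  · simpa only [← Projective.map_addXYZ] using hv'.addXYZ hw' hab

/-- The duplication formula always specialises. -/
lemma Specializes.dbl (hW : W₀.map f = W) (hW' : W₀.map g = W')
    (hA : Specializes f g A a) : Specializes f g (A + A) (a + a) := by
  subst hW hW'
  obtain ⟨v, hv, hv'⟩ := hA
  refine ⟨W₀.toProjective.dblXYZ v, ?_, ?_⟩
  · simpa only [← Projective.map_dblXYZ] using hv.dblXYZ
  · simpa only [← Projective.map_dblXYZ] using hv'.dblXYZ

/-- Multiples of a point specialising to a nonzero point. The chord construction for `A + B`
specialises well as soon as the values of `A` and `B` differ, and duplication always does; these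
two cases suffice to reach every multiple when the value is not zero. -/
lemma Specializes.nsmul_of_ne_zero (hf : Function.Injective f) (hW : W₀.map f = W)
    (hW' : W₀.map g = W') (hA : Specializes f g A a) (ha : a ≠ 0) (n : ℕ) :
    Specializes f g (n • A) (n • a) := by
  induction n using Nat.strong_induction_on with
  | _ n ih =>
    obtain ⟨k, rfl | rfl⟩ := Nat.even_or_odd' n
    · rcases Nat.eq_zero_or_pos k with rfl | hk
      · simpa using specializes_zero
      · have h := ih k (by lia)
        simpa only [two_mul, add_nsmul] using h.dbl hW hW'
    · rcases Nat.eq_zero_or_pos k with rfl | hk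
      · simpa using hA
      · by_cases h1 : (2 * k) • a = a
        · -- Here `(2k - 1) a = 0`, so that `2k - 1` and `2` are the summands to use.
          have h0 : (2 * k - 1) • a = 0 := by
            have : (2 * k) • a = (2 * k - 1) • a + a := by
              rw [← succ_nsmul]
              congr 1
              lia
            rw [this] at h1
            simpa using h1
          have h2 : (2 : ℕ) • a ≠ 0 := by
            intro h2
            apply ha
            rw [← h1, mul_comm, mul_nsmul, ← mul_nsmul, mul_comm, mul_nsmul, h2, nsmul_zero]
          have key := (ih (2 * k - 1) (by lia)).add_of_ne hf hW hW'
            (by simpa only [two_nsmul] using hA.dbl hW hW' : Specializes f g (2 • A) (2 • a))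
            (by rw [h0]; exact h2.symm)
          rw [← add_nsmul, ← add_nsmul] at key
          convert key using 2 <;> lia
        · have key := (ih (2 * k) (by lia)).add_of_ne hf hW hW' hA h1
          simpa only [succ_nsmul] using key

end Specializes

/-! ### The group law near the origin -/

section FormalGroup

variable {O : Type*} [CommRing O] (W₀ : WeierstrassCurve O)

/-- The chord through two points `[z₁ : 1 : w₁]` and `[z₂ : 1 : w₂]` with slope `l` meets the
curve in a third point `[z₃ : 1 : l z₃ + n]`, and the chord formula for the sum is proportional,
with factor `-(z₂ - z₁) ^ 3 E`, to the inverse of this third point. -/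
lemma addXYZ_eq_smul (z₁ z₂ z₃ l n E : O)
    (hE : E = 1 + W₀.a₂ * l + W₀.a₄ * l ^ 2 + W₀.a₆ * l ^ 3)
    (h₁ : W₀.toProjective.Equation ![z₁, 1, l * z₁ + n])
    (h₂ : W₀.toProjective.Equation ![z₂, 1, l * z₂ + n])
    (h₃ : E * (z₁ + z₂ + z₃) = -(W₀.a₂ * n + 2 * W₀.a₄ * l * n + 3 * W₀.a₆ * l ^ 2 * n
      - W₀.a₁ * l - W₀.a₃ * l ^ 2)) :
    W₀.toProjective.addXYZ ![z₁, 1, l * z₁ + n] ![z₂, 1, l * z₂ + n] =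
      (-((z₂ - z₁) ^ 3 * E)) •
        ![z₃, -(1 + W₀.a₁ * z₃ + W₀.a₃ * (l * z₃ + n)), l * z₃ + n] := by
  rw [Projective.equation_iff] at h₁ h₂
  simp only [Matrix.cons_val_zero, Matrix.cons_val_one, Matrix.cons_val] at h₁ h₂
  have hZ : W₀.toProjective.addZ ![z₁, 1, l * z₁ + n] ![z₂, 1, l * z₂ + n] =
      (-((z₂ - z₁) ^ 3 * E)) * (l * z₃ + n) := by
    simp only [Projective.addZ, Matrix.cons_val_zero, Matrix.cons_val_one, Matrix.cons_val]
    subst hE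
    linear_combination ((2 * (l * z₂ + n) - (l * z₁ + n))) * h₁
      + ((l * z₂ + n) - 2 * (l * z₁ + n)) * h₂ + (z₂ - z₁) ^ 3 * l * h₃
  have hX : W₀.toProjective.addX ![z₁, 1, l * z₁ + n] ![z₂, 1, l * z₂ + n] =
      (-((z₂ - z₁) ^ 3 * E)) * z₃ := by
    simp only [Projective.addX, Matrix.cons_val_zero, Matrix.cons_val_one, Matrix.cons_val]
    subst hE
    linear_combination (2 * z₂ - z₁) * h₁ + (z₂ - 2 * z₁) * h₂ + (z₂ - z₁) ^ 3 * h₃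
  have hY : W₀.toProjective.negAddY ![z₁, 1, l * z₁ + n] ![z₂, 1, l * z₂ + n] =
      (-((z₂ - z₁) ^ 3 * E)) := by
    simp only [Projective.negAddY, Matrix.cons_val_zero, Matrix.cons_val_one, Matrix.cons_val]
    subst hE
    linear_combination h₁ - h₂
  rw [Projective.addXYZ, Projective.addY, Projective.negY_eq, hX, hY, hZ]
  funext i
  fin_cases i <;> simp
  ring

/-- Duplication multiplies `z = X / Y` by `2`, to first order; see also `dblY_sub_mem`. -/
lemma dblX_sub_mem {z w : O} {I : Ideal O} (hz : z ^ 2 ∈ I) (hw : w ∈ I) :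
    W₀.toProjective.dblX ![z, 1, w] - 2 * z ∈ I := by
  rw [← Ideal.Quotient.eq_zero_iff_mem] at hz hw ⊢
  rw [map_pow] at hz
  simp only [Projective.dblX, Matrix.cons_val_zero, Matrix.cons_val_one, Matrix.cons_val,
    map_add, map_sub, map_mul, map_pow, map_ofNat, map_one, hw]
  grind

lemma dblY_sub_mem {z w : O} {I : Ideal O} (hz : z ∈ I) (hw : w ∈ I) :
    W₀.toProjective.dblY ![z, 1, w] - 1 ∈ I := by
  rw [← Ideal.Quotient.eq_zero_iff_mem] at hz hw ⊢
  simp only [Projective.dblY, Projective.negY, Projective.dblX, Projective.negDblY,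
    Projective.dblZ, Matrix.cons_val_zero, Matrix.cons_val_one, Matrix.cons_val,
    map_add, map_sub, map_mul, map_pow, map_ofNat, map_one, map_neg, hz, hw]
  ring

variable {F k : Type*} [Field F] [Field k] {f : O →+* F} {g : O →+* k}

/-- Near the origin the coordinate `w = Z / Y` is a multiple of the cube of `z = X / Y`. -/
lemma exists_eq_mul_cube (hg : ∀ x, g x ≠ 0 → IsUnit x) {z w : O} (hz : g z = 0) (hw : g w = 0)
    (h : W₀.toProjective.Equation ![z, 1, w]) : ∃ c, w = c * z ^ 3 := by
  rw [Projective.equation_iff] at h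
  simp only [Matrix.cons_val_zero, Matrix.cons_val_one, Matrix.cons_val] at h
  have hu : IsUnit (1 - W₀.a₂ * z ^ 2 - W₀.a₄ * z * w - W₀.a₆ * w ^ 2 + W₀.a₁ * z + W₀.a₃ * w) :=
    hg _ (by simp [hz, hw])
  obtain ⟨c, hc⟩ := hu.exists_left_inv
  exact ⟨c, by linear_combination -w * hc + c * h⟩

variable {W₀} {W : WeierstrassCurve F} {A B : W.toAffine.Point}

/-- Coordinates of the form `[z : 1 : w]` are unique. -/
lemma isRep_unique {z₁ w₁ z₂ w₂ : O} (hf : Function.Injective f)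
    (h₁ : IsRep (f ∘ ![z₁, 1, w₁]) A) (h₂ : IsRep (f ∘ ![z₂, 1, w₂]) A) : z₁ = z₂ ∧ w₁ = w₂ := by
  have h0 := h₁.cross h₂ 0 1
  have h1 := h₁.cross h₂ 2 1
  simp only [Function.comp_apply, Matrix.cons_val_zero, Matrix.cons_val_one, Matrix.cons_val,
    map_one, one_mul, mul_one] at h0 h1
  exact ⟨hf h0, hf h1⟩

variable {W' : WeierstrassCurve k} {a : W'.toAffine.Point}

/-- A point specialising to the origin has coordinates `[z : 1 : w]` over the local ring. -/
lemma Specializes.exists_isRep (hg : ∀ x, g x ≠ 0 → IsUnit x)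
    (h : Specializes f g A (0 : W'.toAffine.Point)) :
    ∃ z w, g z = 0 ∧ g w = 0 ∧ IsRep (f ∘ ![z, 1, w]) A := by
  obtain ⟨v, hv, c, hc, h⟩ := h
  have h0 : g (v 0) = 0 := by simpa [coords] using h 0
  have h1 : g (v 1) = c := by simpa [coords] using h 1
  have h2 : g (v 2) = 0 := by simpa [coords] using h 2
  have hu : IsUnit (v 1) := hg _ (h1 ▸ hc)
  obtain ⟨u, hu'⟩ := hu.exists_right_inv
  refine ⟨v 0 * u, v 2 * u, by simp [h0], by simp [h2], IsRep.of_smul (c := f (v 1)) ?_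
    (hu.map f).ne_zero⟩
  convert hv using 1
  have hfu : f (v 1) * f u = 1 := by rw [← map_mul, hu', map_one]
  funext i
  fin_cases i
  · change f (v 1) * f (v 0 * u) = f (v 0)
    rw [map_mul]
    linear_combination f (v 0) * hfu
  · change f (v 1) * f 1 = f (v 1)
    rw [map_one, mul_one]
  · change f (v 1) * f (v 2 * u) = f (v 2)
    rw [map_mul]
    linear_combination f (v 2) * hfu

variable [DecidableEq F]

/-- The group law near the origin: if the two points have coordinates `[zᵢ : 1 : wᵢ]` reducing to
`[0 : 1 : 0]`, so has their sum, and `z (A + B) ≡ z (A) + z (B)` up to terms of second order. -/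
lemma exists_isRep_add (hf : Function.Injective f) (hg : ∀ x, g x ≠ 0 → IsUnit x)
    (hW : W₀.map f = W) {z₁ w₁ z₂ w₂ : O} (hz₁ : g z₁ = 0) (hw₁ : g w₁ = 0) (hz₂ : g z₂ = 0)
    (hw₂ : g w₂ = 0) (hA : IsRep (f ∘ ![z₁, 1, w₁]) A) (hB : IsRep (f ∘ ![z₂, 1, w₂]) B) :
    ∃ z₃ w₃, g z₃ = 0 ∧ g w₃ = 0 ∧ IsRep (f ∘ ![z₃, 1, w₃]) (A + B) ∧
      z₃ - (z₁ + z₂) ∈ Ideal.span {z₁, z₂} ^ 2 := by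
  subst hW
  set I := Ideal.span {z₁, z₂} with hI
  have hz₁I : z₁ ∈ I := Ideal.subset_span (by simp)
  have hz₂I : z₂ ∈ I := Ideal.subset_span (by simp)
  have hle : I ^ 2 ≤ I := Ideal.pow_le_self two_ne_zero
  have mulI : ∀ {x y}, x ∈ I → y ∈ I → x * y ∈ I ^ 2 := fun hx hy => by
    rw [pow_two]; exact Ideal.mul_mem_mul hx hy
  have h₁ : W₀.toProjective.Equation ![z₁, 1, w₁] :=
    (Projective.map_equation W₀.toProjective hf _).mp hA.equation
  have h₂ : W₀.toProjective.Equation ![z₂, 1, w₂] :=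
    (Projective.map_equation W₀.toProjective hf _).mp hB.equation
  have hw₁I : w₁ ∈ I ^ 2 := by
    obtain ⟨c, rfl⟩ := exists_eq_mul_cube W₀ hg hz₁ hw₁ h₁
    rw [show c * z₁ ^ 3 = c * z₁ * z₁ ^ 2 by ring]
    exact (I ^ 2).mul_mem_left _ (Ideal.pow_mem_pow hz₁I 2)
  have fne : ∀ {x}, IsUnit x → f x ≠ 0 := fun hx => (hx.map f).ne_zero
  by_cases hAB : A = B
  · subst hAB
    obtain ⟨rfl, rfl⟩ := isRep_unique hf hA hB
    have hX := dblX_sub_mem W₀ (Ideal.pow_mem_pow hz₁I 2) hw₁I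
    have hY := dblY_sub_mem W₀ hz₁I (hle hw₁I)
    have hrep := hA.dblXYZ
    have hgv : g ∘ ![z₁, 1, w₁] = ![0, 1, 0] := by
      funext i; fin_cases i <;> simp [hz₁, hw₁]
    have hgd := Projective.map_dblXYZ (W' := W₀.toProjective) (f := g) ![z₁, 1, w₁]
    rw [hgv, Projective.dblXYZ_of_Z_eq_zero Projective.equation_zero (by simp)] at hgd
    have hgX := congrFun hgd 0
    have hgY := congrFun hgd 1
    have hgZ := congrFun hgd 2
    simp only [Projective.dblXYZ, Function.comp_apply, Matrix.cons_val_zero, Matrix.cons_val_one,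
      Matrix.cons_val, Pi.smul_apply, smul_eq_mul, one_pow, mul_zero, mul_one] at hgX hgY hgZ
    set X := W₀.toProjective.dblX ![z₁, 1, w₁]
    set Y := W₀.toProjective.dblY ![z₁, 1, w₁]
    set Z := W₀.toProjective.dblZ ![z₁, 1, w₁]
    have hu : IsUnit Y := hg _ (by rw [← hgY]; exact one_ne_zero)
    obtain ⟨Y', hY'⟩ := hu.exists_right_inv
    refine ⟨X * Y', Z * Y', by simp [← hgX], by simp [← hgZ], ?_, ?_⟩
    · rw [Projective.map_dblXYZ] at hrep
      refine IsRep.of_smul (c := f Y) ?_ (fne hu)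
      convert hrep using 1
      funext i
      have hfY : f Y * f Y' = 1 := by rw [← map_mul, hY', map_one]
      fin_cases i
      · change f Y * f (X * Y') = f X
        rw [map_mul]
        linear_combination f X * hfY
      · change f Y * f 1 = f Y
        rw [map_one, mul_one]
      · change f Y * f (Z * Y') = f Z
        rw [map_mul]
        linear_combination f Z * hfY
    · have : X * Y' - (z₁ + z₁) = Y' * (X - 2 * z₁) + -2 * Y' * (z₁ * (Y - 1)) := by
        linear_combination 2 * z₁ * hY'
      rw [this]
      exact add_mem ((I ^ 2).mul_mem_left _ hX) ((I ^ 2).mul_mem_left _ (mulI hz₁I hY))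
  · have hrep := hA.addXYZ hB hAB
    have e₁ := (Projective.equation_iff _).mp h₁
    have e₂ := (Projective.equation_iff _).mp h₂
    simp only [Matrix.cons_val_zero, Matrix.cons_val_one, Matrix.cons_val] at e₁ e₂
    -- Subtracting the two equations gives `D (w₂ - w₁) = N (z₂ - z₁)` with `D` a unit.
    obtain ⟨D, hD⟩ : ∃ D, D = 1 - W₀.a₂ * z₂ ^ 2 - W₀.a₄ * z₂ * (w₁ + w₂)
      - W₀.a₆ * (w₁ ^ 2 + w₁ * w₂ + w₂ ^ 2) + W₀.a₁ * z₂ + W₀.a₃ * (w₁ + w₂) := ⟨_, rfl⟩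
    obtain ⟨N, hN⟩ : ∃ N, N = z₁ * z₁ + z₁ * z₂ + z₂ * z₂ +
      (W₀.a₂ * (z₁ + z₂) + W₀.a₄ * w₁ - W₀.a₁) * w₁ := ⟨_, rfl⟩
    have hDN : D * (w₂ - w₁) = N * (z₂ - z₁) := by
      subst hD hN
      linear_combination e₂ - e₁
    have hDu : IsUnit D := hg _ (by simp [hD, hw₁, hz₂, hw₂])
    obtain ⟨D', hD'⟩ := hDu.exists_left_inv
    obtain ⟨l, hl⟩ : ∃ l, l = D' * N := ⟨_, rfl⟩
    obtain ⟨n, hn⟩ : ∃ n, n = w₁ - l * z₁ := ⟨_, rfl⟩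
    have hw₁' : w₁ = l * z₁ + n := by rw [hn]; ring
    have hw₂' : w₂ = l * z₂ + n := by
      rw [hn, hl]
      linear_combination -(w₂ - w₁) * hD' + D' * hDN
    have hNI : N ∈ I ^ 2 := by
      rw [hN]
      exact add_mem (add_mem (add_mem (mulI hz₁I hz₁I) (mulI hz₁I hz₂I)) (mulI hz₂I hz₂I))
        ((I ^ 2).mul_mem_left _ hw₁I)
    have hlI : l ∈ I ^ 2 := by rw [hl]; exact (I ^ 2).mul_mem_left _ hNI
    have hnI : n ∈ I ^ 2 := by rw [hn]; exact sub_mem hw₁I ((I ^ 2).mul_mem_right _ hlI)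
    have hgI : ∀ x ∈ I, g x = 0 := by
      have : I ≤ RingHom.ker g := by
        rw [hI, Ideal.span_le]
        rintro x (rfl | rfl)
        exacts [hz₁, hz₂]
      exact fun x hx => this hx
    have hgl : g l = 0 := hgI _ (hle hlI)
    have hgn : g n = 0 := hgI _ (hle hnI)
    obtain ⟨E, hE⟩ : ∃ E, E = 1 + W₀.a₂ * l + W₀.a₄ * l ^ 2 + W₀.a₆ * l ^ 3 := ⟨_, rfl⟩
    have hEu : IsUnit E := hg _ (by simp [hE, hgl])
    obtain ⟨E', hE'⟩ := hEu.exists_right_inv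
    obtain ⟨T, hT⟩ : ∃ T, T = W₀.a₂ * n + 2 * W₀.a₄ * l * n + 3 * W₀.a₆ * l ^ 2 * n
      - W₀.a₁ * l - W₀.a₃ * l ^ 2 := ⟨_, rfl⟩
    have hTI : T ∈ I ^ 2 := by
      have : T = (W₀.a₂ + 2 * W₀.a₄ * l + 3 * W₀.a₆ * l ^ 2) * n + (-W₀.a₁ - W₀.a₃ * l) * l := by
        rw [hT]; ring
      rw [this]
      exact add_mem ((I ^ 2).mul_mem_left _ hnI) ((I ^ 2).mul_mem_left _ hlI)
    obtain ⟨z, hz⟩ : ∃ z, z = -(z₁ + z₂) - E' * T := ⟨_, rfl⟩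
    obtain ⟨w, hw⟩ : ∃ w, w = l * z + n := ⟨_, rfl⟩
    have hzI : z ∈ I := by
      rw [hz]
      exact sub_mem (neg_mem (add_mem hz₁I hz₂I)) (hle ((I ^ 2).mul_mem_left _ hTI))
    have hwI : w ∈ I := by
      rw [hw]
      exact add_mem (I.mul_mem_left _ hzI) (hle hnI)
    have key := addXYZ_eq_smul W₀ z₁ z₂ z l n E hE (hw₁' ▸ h₁) (hw₂' ▸ h₂) (by
      rw [← hT, hz]
      linear_combination -T * hE')
    rw [← hw₁', ← hw₂', ← hw] at key
    obtain ⟨U, hU⟩ : ∃ U, U = 1 + W₀.a₁ * z + W₀.a₃ * w := ⟨_, rfl⟩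
    rw [← hU] at key
    have hUu : IsUnit U := hg _ (by simp [hU, hgI _ hzI, hgI _ hwI])
    obtain ⟨U', hU'⟩ := hUu.exists_right_inv
    refine ⟨-(z * U'), -(w * U'), by simp [hgI _ hzI], by simp [hgI _ hwI], ?_, ?_⟩
    · have hz₁₂ : z₂ - z₁ ≠ 0 := by
        intro h0
        rw [h0, mul_zero] at hDN
        have hw : w₂ - w₁ = 0 := hDu.mul_right_eq_zero.mp hDN
        rw [sub_eq_zero] at h0 hw
        subst h0 hw
        exact hAB (hA.eq hB)
      rw [Projective.map_addXYZ, key] at hrep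
      refine IsRep.of_smul (c := f ((z₂ - z₁) ^ 3 * E * U)) ?_ ?_
      · convert hrep using 1
        funext i
        fin_cases i
        · change f ((z₂ - z₁) ^ 3 * E * U) * f (-(z * U')) = f (-((z₂ - z₁) ^ 3 * E) * z)
          rw [← map_mul]
          congr 1
          linear_combination -(z₂ - z₁) ^ 3 * E * z * hU'
        · change f ((z₂ - z₁) ^ 3 * E * U) * f 1 = f (-((z₂ - z₁) ^ 3 * E) * -U)
          rw [← map_mul]
          congr 1
          ring
        · change f ((z₂ - z₁) ^ 3 * E * U) * f (-(w * U')) = f (-((z₂ - z₁) ^ 3 * E) * w)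
          rw [← map_mul]
          congr 1
          linear_combination -(z₂ - z₁) ^ 3 * E * w * hU'
      · rw [map_mul, map_mul, map_pow]
        exact mul_ne_zero (mul_ne_zero (pow_ne_zero _ ((map_ne_zero_iff f hf).mpr hz₁₂))
          (fne hEu)) (fne hUu)
    · have : -(z * U') - (z₁ + z₂) = E' * T + U' * (z * (W₀.a₁ * z + W₀.a₃ * w)) := by
        have h1 : -(z * U') = -z + U' * (z * (W₀.a₁ * z + W₀.a₃ * w)) := by
          rw [hU] at hU'
          linear_combination -z * hU'
        rw [h1, hz]
        ring
      rw [this]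
      exact add_mem ((I ^ 2).mul_mem_left _ hTI) ((I ^ 2).mul_mem_left _
        (mulI hzI (add_mem (I.mul_mem_left _ hzI) (I.mul_mem_left _ hwI))))

/-- Multiples of a point near the origin: `z (n A) ≡ n z (A)` up to terms of second order. -/
lemma exists_isRep_nsmul (hf : Function.Injective f) (hg : ∀ x, g x ≠ 0 → IsUnit x)
    (hW : W₀.map f = W) {z w : O} (hz : g z = 0) (hw : g w = 0)
    (hA : IsRep (f ∘ ![z, 1, w]) A) (n : ℕ) :
    ∃ z' w', g z' = 0 ∧ g w' = 0 ∧ IsRep (f ∘ ![z', 1, w']) (n • A) ∧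
      ∃ c, z' = n * z + c * z ^ 2 := by
  induction n with
  | zero => exact ⟨0, 0, by simp, by simp, by simpa using isRep_map_zero f, 0, by simp⟩
  | succ n ih =>
    obtain ⟨z', w', hz', hw', hrep, c, hc⟩ := ih
    obtain ⟨z₃, w₃, hz₃, hw₃, hrep₃, hmem⟩ := exists_isRep_add hf hg hW hz' hw' hz hw hrep hA
    refine ⟨z₃, w₃, hz₃, hw₃, by rwa [succ_nsmul], ?_⟩
    have hle : Ideal.span {z', z} ^ 2 ≤ Ideal.span {z ^ 2} := by
      rw [← Ideal.span_singleton_pow]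
      refine Ideal.pow_right_mono ?_ 2
      rw [Ideal.span_le]
      rintro x (rfl | rfl)
      · rw [SetLike.mem_coe, Ideal.mem_span_singleton']
        exact ⟨n + c * z, by rw [hc]; ring⟩
      · exact Ideal.mem_span_singleton_self _
    obtain ⟨d, hd⟩ := Ideal.mem_span_singleton'.mp (hle hmem)
    exact ⟨c + d, by push_cast; linear_combination hc - hd⟩

variable [DecidableEq k]

/-- Specialisation over a local ring is compatible with multiples. -/
lemma Specializes.nsmul (hf : Function.Injective f) (hg : ∀ x, g x ≠ 0 → IsUnit x)
    (hW : W₀.map f = W) (hW' : W₀.map g = W') (h : Specializes f g A a) (n : ℕ) :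
    Specializes f g (n • A) (n • a) := by
  by_cases ha : a = 0
  · subst ha
    obtain ⟨z, w, hz, hw, hrep⟩ := h.exists_isRep hg
    obtain ⟨z', w', hz', hw', hrep', -⟩ := exists_isRep_nsmul hf hg hW hz hw hrep n
    rw [nsmul_zero]
    refine ⟨_, hrep', 1, one_ne_zero, fun i => ?_⟩
    change g (![z', 1, w'] i) = 1 * ![0, 1, 0] i
    fin_cases i <;> simp [hz', hw']
  · exact h.nsmul_of_ne_zero hf hW hW' ha n

end FormalGroup

/-! ### The local ring of the base -/

section BaseLocalRing

variable {R : Type*} [CommRing R] [Algebra ℂ R] (b : R →ₐ[ℂ] ℂ)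

instance isPrime_ker_point : (RingHom.ker (b : R →+* ℂ)).IsPrime := RingHom.ker_isPrime _

/-- The local ring of the base at the complex point `b`. -/
abbrev BaseLocalRing : Type _ := Localization.AtPrime (RingHom.ker (b : R →+* ℂ))

/-- The value at `b` of a function on the base that is regular at `b`. -/
def baseEval : BaseLocalRing b →+* ℂ :=
  IsLocalization.lift (M := (RingHom.ker (b : R →+* ℂ)).primeCompl) (g := (b : R →+* ℂ))
    fun s => isUnit_iff_ne_zero.mpr s.2

@[simp]
lemma baseEval_algebraMap (r : R) : baseEval b (algebraMap R _ r) = b r :=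
  IsLocalization.lift_eq _ r

lemma exists_mul_eq_algebraMap (x : BaseLocalRing b) :
    ∃ r s : R, b s ≠ 0 ∧ x * algebraMap R _ s = algebraMap R _ r := by
  obtain ⟨⟨r, s⟩, h⟩ := IsLocalization.surj (RingHom.ker (b : R →+* ℂ)).primeCompl x
  exact ⟨r, s, s.2, h⟩

lemma isUnit_algebraMap {s : R} (hs : b s ≠ 0) : IsUnit (algebraMap R (BaseLocalRing b) s) :=
  IsLocalization.map_units _ (⟨s, hs⟩ : (RingHom.ker (b : R →+* ℂ)).primeCompl)

lemma isUnit_of_baseEval_ne_zero (x : BaseLocalRing b) (hx : baseEval b x ≠ 0) : IsUnit x := by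
  obtain ⟨r, s, hs, h⟩ := exists_mul_eq_algebraMap b x
  have hr : b r ≠ 0 := by
    rw [← baseEval_algebraMap, ← h, map_mul, baseEval_algebraMap]
    exact mul_ne_zero hx hs
  exact isUnit_of_mul_isUnit_left (h ▸ isUnit_algebraMap b hr)

lemma algebraMap_baseLocalRing_injective [IsDomain R] :
    Function.Injective (algebraMap R (BaseLocalRing b)) :=
  IsLocalization.injective _
    (Ideal.primeCompl_le_nonZeroDivisors (RingHom.ker (b : R →+* ℂ)))

variable (K : Type*) [Field K] [Algebra R K] [IsFractionRing R K]

/-- The inclusion of the local ring of the base at `b` into the function field of the base. -/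
def baseLocalToField : BaseLocalRing b →+* K :=
  IsLocalization.lift (M := (RingHom.ker (b : R →+* ℂ)).primeCompl) (g := algebraMap R K)
    fun s => isUnit_iff_ne_zero.mpr <| (map_ne_zero_iff _ (IsFractionRing.injective R K)).mpr <| by
      rintro h
      exact s.2 (h ▸ Ideal.zero_mem _)

@[simp]
lemma baseLocalToField_algebraMap (r : R) :
    baseLocalToField b K (algebraMap R _ r) = algebraMap R K r :=
  IsLocalization.lift_eq _ r

lemma baseLocalToField_injective [IsDomain R] : Function.Injective (baseLocalToField b K) :=
  (IsLocalization.lift_injective_iff _).mpr fun x y => by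
    rw [(algebraMap_baseLocalRing_injective b).eq_iff, (IsFractionRing.injective R K).eq_iff]

end BaseLocalRing

/-- The maximal ideal of a complex point is not zero, as `R` is not `ℂ`. -/
lemma ker_point_ne_bot {R : Type*} [CommRing R] [Algebra ℂ R] (b : R →ₐ[ℂ] ℂ)
    (hR : ¬ IsField R) : RingHom.ker (b : R →+* ℂ) ≠ ⊥ := by
  intro h
  apply hR
  have hinj : Function.Injective (b : R →+* ℂ) := (RingHom.injective_iff_ker_eq_bot _).mpr h
  have hsurj : Function.Surjective (b : R →+* ℂ) := fun c => ⟨algebraMap ℂ R c, by simp⟩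
  exact (RingEquiv.ofBijective _ ⟨hinj, hsurj⟩).toMulEquiv.isField (Field.toIsField ℂ)

/-! ### Restriction of functions on the surface to the section -/

/-- A form of degree `d` scales with the `d`-th power of the factor. -/
lemma eval₂_smul_of_isHomogeneous {R S : Type*} [CommRing R] [CommRing S] (f : R →+* S) {d : ℕ}
    {F : MvPolynomial (Fin 3) R} (hF : F.IsHomogeneous d) (c : S) (v w : Fin 3 → S)
    (h : ∀ i, v i = c * w i) :
    MvPolynomial.eval₂ f v F = c ^ d * MvPolynomial.eval₂ f w F := by
  rw [MvPolynomial.eval₂_eq', MvPolynomial.eval₂_eq', Finset.mul_sum]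
  refine Finset.sum_congr rfl fun e he => ?_
  have hd : ∑ i, e i = d := by
    have := hF (MvPolynomial.mem_support_iff.mp he)
    rw [Finsupp.weight_apply, Finsupp.sum_fintype _ _ (by simp)] at this
    simpa using this
  simp_rw [h, mul_pow, Finset.prod_mul_distrib, Finset.prod_pow_eq_pow_sum, hd]
  ring

section Restriction

variable {R : Type*} [CommRing R] [IsDomain R] {W : WeierstrassCurve R} [W.IsElliptic]
  {K : Type*} [Field K] [Algebra R K] {σ : (W.map (algebraMap R K)).toAffine.Point}

/-- A form which vanishes on the surface vanishes along the section. -/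
lemma eval₂_section_eq_zero (hσ : σ ≠ 0) (H : MvPolynomial (Fin 3) R)
    (h : MvPolynomial.eval₂ (baseToField W) (coords (genericPoint W)) H = 0) :
    MvPolynomial.eval₂ (algebraMap R K) (coords σ) H = 0 := by
  rcases σ with _ | ⟨x, y, hxy⟩
  · exact absurd rfl hσ
  let mk := Affine.CoordinateRing.mk W.toAffine
  let v : Fin 3 → W.toAffine.CoordinateRing :=
    ![mk (Polynomial.C Polynomial.X), mk Polynomial.X, 1]
  have h0 : MvPolynomial.eval₂ (algebraMap R W.toAffine.CoordinateRing) v H = 0 := by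
    apply IsFractionRing.injective W.toAffine.CoordinateRing (SurfaceField W)
    rw [MvPolynomial.hom_eval₂, map_zero, ← h]
    congr 1
    funext i
    change _ = ![genericX W, genericY W, 1] i
    fin_cases i
    · rfl
    · rfl
    · exact map_one _
  let ψ : W.toAffine.CoordinateRing →+* K :=
    AdjoinRoot.lift (Polynomial.eval₂RingHom (algebraMap R K) x) y <| by
      have := (Affine.equation_iff _ _).mp hxy.1
      simp only [map_a₁, map_a₂, map_a₃, map_a₄, map_a₆] at this
      simp only [Affine.polynomial, Polynomial.eval₂_add, Polynomial.eval₂_sub,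
        Polynomial.eval₂_mul, Polynomial.eval₂_pow, Polynomial.eval₂_X, Polynomial.eval₂_C,
        Polynomial.coe_eval₂RingHom]
      linear_combination this
  have h1 := congrArg ψ h0
  rw [MvPolynomial.hom_eval₂, map_zero] at h1
  rw [← h1]
  congr 1
  · ext r
    change _ = ψ (mk (Polynomial.C (Polynomial.C r)))
    rw [AdjoinRoot.lift_mk]
    simp
  · funext i
    change ![x, y, 1] i = _
    fin_cases i
    · change x = ψ (mk (Polynomial.C Polynomial.X))
      rw [AdjoinRoot.lift_mk]
      simp
    · change y = ψ (mk Polynomial.X)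
      rw [AdjoinRoot.lift_mk]
      simp
    · exact (map_one _).symm

variable [Algebra ℂ R] {b : R →ₐ[ℂ] ℂ} {P : (fibre W b).toAffine.Point}

/-- Two fractions of forms which agree on the surface agree, after clearing denominators, on the
section; hence restriction to the section does not depend on the fraction. -/
lemma IsGerm.cross_section (hσ : σ ≠ 0) {F G F' G' : MvPolynomial (Fin 3) R} {x : SurfaceField W}
    (h : IsGerm W P F G x) (h' : IsGerm W P F' G' x) :
    MvPolynomial.eval₂ (algebraMap R K) (coords σ) F *
        MvPolynomial.eval₂ (algebraMap R K) (coords σ) G' =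
      MvPolynomial.eval₂ (algebraMap R K) (coords σ) F' *
        MvPolynomial.eval₂ (algebraMap R K) (coords σ) G := by
  have key := eval₂_section_eq_zero hσ (F * G' + -(F' * G)) <| by
    obtain ⟨-, -, hG, rfl⟩ := h
    obtain ⟨-, -, hG', he⟩ := h'
    rw [div_eq_div_iff hG hG'] at he
    rw [MvPolynomial.eval₂_add, ← MvPolynomial.coe_eval₂Hom, map_neg, map_mul, map_mul]
    simp only [MvPolynomial.coe_eval₂Hom]
    rw [he, add_neg_cancel]
  rw [MvPolynomial.eval₂_add, ← MvPolynomial.coe_eval₂Hom, map_neg, map_mul, map_mul] at key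
  simp only [MvPolynomial.coe_eval₂Hom] at key
  linear_combination key

variable [IsFractionRing R K]

/-- The restriction to the section of a function that is regular at `P`. -/
lemma IsGerm.exists_restriction (hP : IsValueAt W σ b P) {F G : MvPolynomial (Fin 3) R}
    {x : SurfaceField W} (h : IsGerm W P F G x) :
    MvPolynomial.eval₂ (algebraMap R K) (coords σ) G ≠ 0 ∧ ∃ y : BaseLocalRing b,
      baseLocalToField b K y * MvPolynomial.eval₂ (algebraMap R K) (coords σ) G =
        MvPolynomial.eval₂ (algebraMap R K) (coords σ) F ∧
      baseEval b y * MvPolynomial.eval₂ (b : R →+* ℂ) (coords P) G =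
        MvPolynomial.eval₂ (b : R →+* ℂ) (coords P) F := by
  obtain ⟨v, ⟨c, hc, hvc⟩, c', hc', hvc'⟩ := hP
  obtain ⟨⟨d, hF, hG⟩, hGP, -, -⟩ := h
  have hK : ∀ {H : MvPolynomial (Fin 3) R}, H.IsHomogeneous d →
      algebraMap R K (MvPolynomial.eval v H) =
        c ^ d * MvPolynomial.eval₂ (algebraMap R K) (coords σ) H := fun hH => by
    rw [MvPolynomial.eval₂_comp]
    exact eval₂_smul_of_isHomogeneous _ hH c _ _ hvc
  have hb : ∀ {H : MvPolynomial (Fin 3) R}, H.IsHomogeneous d →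
      b (MvPolynomial.eval v H) =
        c' ^ d * MvPolynomial.eval₂ (b : R →+* ℂ) (coords P) H := fun hH => by
    change (b : R →+* ℂ) _ = _
    rw [MvPolynomial.eval₂_comp]
    exact eval₂_smul_of_isHomogeneous _ hH c' _ _ hvc'
  have hbG : b (MvPolynomial.eval v G) ≠ 0 := by
    rw [hb hG]
    exact mul_ne_zero (pow_ne_zero _ hc') hGP
  have hGσ : MvPolynomial.eval₂ (algebraMap R K) (coords σ) G ≠ 0 := by
    intro h0
    apply hbG
    have := hK hG
    rw [h0, mul_zero, map_eq_zero_iff _ (IsFractionRing.injective R K)] at this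
    rw [this, map_zero]
  refine ⟨hGσ, ?_⟩
  obtain ⟨u, hu⟩ := (isUnit_algebraMap b hbG).exists_right_inv
  refine ⟨algebraMap R _ (MvPolynomial.eval v F) * u, ?_, ?_⟩
  · have h1 := congrArg (baseLocalToField b K) hu
    rw [map_mul, baseLocalToField_algebraMap, hK hG, map_one] at h1
    rw [map_mul, baseLocalToField_algebraMap, hK hF]
    linear_combination MvPolynomial.eval₂ (algebraMap R K) (coords σ) F * h1
  · have h1 := congrArg (baseEval b) hu
    rw [map_mul, baseEval_algebraMap, hb hG, map_one] at h1
    rw [map_mul, baseEval_algebraMap, hb hF]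
    linear_combination MvPolynomial.eval₂ (b : R →+* ℂ) (coords P) F * h1

lemma exists_restriction (hσ : σ ≠ 0) (hP : IsValueAt W σ b P) (x : localRing W P) :
    ∃ y : BaseLocalRing b, ∀ F G, IsGerm W P F G x →
      baseLocalToField b K y * MvPolynomial.eval₂ (algebraMap R K) (coords σ) G =
        MvPolynomial.eval₂ (algebraMap R K) (coords σ) F := by
  obtain ⟨F, G, h⟩ := x.2
  obtain ⟨hG, y, hy, -⟩ := h.exists_restriction hP
  refine ⟨y, fun F' G' h' => mul_right_cancel₀ hG ?_⟩
  rw [← IsGerm.cross_section hσ h h', ← hy]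
  ring

/-- The restriction to the section `σ` of the functions on the surface that are regular at the
value `P` of `σ` at `b`. -/
def restriction (hσ : σ ≠ 0) (hP : IsValueAt W σ b P) : localRing W P →+* BaseLocalRing b :=
  RingHom.mk'
    { toFun := fun x => (exists_restriction hσ hP x).choose
      map_one' := by
        apply baseLocalToField_injective b K
        have h := (exists_restriction hσ hP (1 : localRing W P)).choose_spec (MvPolynomial.C 1) 1
          (by simpa using isGerm_C (W := W) (P := P) 1)
        simpa using h
      map_mul' := fun x y => by
        obtain ⟨F, G, h⟩ := x.2
        obtain ⟨F', G', h'⟩ := y.2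
        have h₁ := (exists_restriction hσ hP x).choose_spec F G h
        have h₂ := (exists_restriction hσ hP y).choose_spec F' G' h'
        have h₃ := (exists_restriction hσ hP (x * y)).choose_spec _ _ (h.mul h')
        apply baseLocalToField_injective b K
        apply mul_right_cancel₀ ((h.mul h').exists_restriction hP).1
        rw [h₃, map_mul, MvPolynomial.eval₂_mul, MvPolynomial.eval₂_mul, ← h₁, ← h₂]
        ring }
    fun x y => by
      obtain ⟨F, G, h⟩ := x.2
      obtain ⟨F', G', h'⟩ := y.2
      have h₁ := (exists_restriction hσ hP x).choose_spec F G h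
      have h₂ := (exists_restriction hσ hP y).choose_spec F' G' h'
      have h₃ := (exists_restriction hσ hP (x + y)).choose_spec _ _ (h.add h')
      apply baseLocalToField_injective b K
      apply mul_right_cancel₀ ((h.add h').exists_restriction hP).1
      refine h₃.trans ?_
      rw [map_add, MvPolynomial.eval₂_add, MvPolynomial.eval₂_mul, MvPolynomial.eval₂_mul,
        MvPolynomial.eval₂_mul, ← h₁, ← h₂]
      simp only [MonoidHom.coe_mk, OneHom.coe_mk]
      ring

variable (hσ : σ ≠ 0) (hP : IsValueAt W σ b P)

lemma restriction_spec {x : localRing W P} {F G : MvPolynomial (Fin 3) R}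
    (h : IsGerm W P F G x) :
    baseLocalToField b K (restriction hσ hP x) *
      MvPolynomial.eval₂ (algebraMap R K) (coords σ) G =
        MvPolynomial.eval₂ (algebraMap R K) (coords σ) F :=
  (exists_restriction hσ hP x).choose_spec F G h

lemma baseEval_restriction {x : localRing W P} {F G : MvPolynomial (Fin 3) R}
    (h : IsGerm W P F G x) :
    baseEval b (restriction hσ hP x) * MvPolynomial.eval₂ (b : R →+* ℂ) (coords P) G =
        MvPolynomial.eval₂ (b : R →+* ℂ) (coords P) F := by
  obtain ⟨hG, y, hy, hy'⟩ := h.exists_restriction hP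
  rw [← hy']
  congr 2
  apply baseLocalToField_injective b K
  exact mul_right_cancel₀ hG ((restriction_spec hσ hP h).trans hy.symm)

/-- The functions on the base, as regular functions on the surface at `P`. -/
def baseToLocalRing (W : WeierstrassCurve R) [W.IsElliptic] (P : (fibre W b).toAffine.Point) :
    R →+* localRing W P :=
  (baseToField W).codRestrict (localRing W P) fun r => ⟨_, _, isGerm_C r⟩

@[simp]
lemma restriction_baseToLocalRing (r : R) :
    restriction hσ hP (baseToLocalRing W P r) = algebraMap R _ r := by
  apply baseLocalToField_injective b K
  have := restriction_spec hσ hP (x := baseToLocalRing W P r) (isGerm_C r)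
  simpa using this

/-- A function whose value at `P` is not zero is a unit of the local ring at `P`. -/
lemma isUnit_of_baseEval_restriction_ne_zero (x : localRing W P)
    (hx : baseEval b (restriction hσ hP x) ≠ 0) : IsUnit x := by
  obtain ⟨F, G, h⟩ := x.2
  have hF : MvPolynomial.eval₂ (b : R →+* ℂ) (coords P) F ≠ 0 := by
    rw [← baseEval_restriction hσ hP h]
    exact mul_ne_zero hx h.2.1
  have hx0 : (x : SurfaceField W) ≠ 0 := by
    intro h0
    have : x = 0 := Subtype.ext h0
    rw [this, map_zero, map_zero] at hx
    exact hx rfl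
  have hFη : MvPolynomial.eval₂ (baseToField W) (coords (genericPoint W)) F ≠ 0 := by
    intro h0
    apply hx0
    rw [h.2.2.2, h0, zero_div]
  obtain ⟨⟨d, hd, hd'⟩, -, hGη, he⟩ := h
  have hinv : (x : SurfaceField W)⁻¹ ∈ localRing W P :=
    ⟨G, F, ⟨d, hd', hd⟩, hF, hFη, by rw [he, inv_div]⟩
  exact IsUnit.of_mul_eq_one (⟨_, hinv⟩ : localRing W P) (Subtype.ext (mul_inv_cancel₀ hx0))

lemma restriction_surjective : Function.Surjective (restriction hσ hP) := by
  intro y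
  obtain ⟨r, s, hs, h⟩ := exists_mul_eq_algebraMap b y
  have hu : IsUnit (baseToLocalRing W P s) :=
    isUnit_of_baseEval_restriction_ne_zero hσ hP _ (by simpa using hs)
  obtain ⟨u, hu⟩ := hu.exists_right_inv
  refine ⟨baseToLocalRing W P r * u, ?_⟩
  have h1 := congrArg (restriction hσ hP) hu
  rw [map_mul, restriction_baseToLocalRing, map_one] at h1
  rw [map_mul, restriction_baseToLocalRing, ← h, mul_assoc, h1, mul_one]

lemma sectionIdeal_eq_ker : sectionIdeal W P σ = RingHom.ker (restriction hσ hP) := by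
  apply le_antisymm
  · refine Ideal.span_le.mpr ?_
    rintro x ⟨F, G, h, h0⟩
    have := restriction_spec hσ hP h
    rw [h0, mul_eq_zero, or_iff_left (h.exists_restriction hP).1,
      map_eq_zero_iff _ (baseLocalToField_injective b K)] at this
    exact this
  · intro x hx
    obtain ⟨F, G, h⟩ := x.2
    refine Ideal.subset_span ⟨F, G, h, ?_⟩
    rw [← restriction_spec hσ hP h, (RingHom.mem_ker).mp hx, map_zero, zero_mul]

end Restriction

/-! ### The intersection multiplicity as an order of vanishing -/

/-- The length of a quotient by `ker θ + (z)` is the order of the image of `z`, for surjective `θ`.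
-/
lemma length_quotient_ker_sup_span {A B : Type*} [CommRing A] [CommRing B] (θ : A →+* B)
    (hθ : Function.Surjective θ) (z : A) :
    Module.length A (A ⧸ (RingHom.ker θ ⊔ Ideal.span {z})) = Ring.ord B (θ z) := by
  let _ : Algebra A B := θ.toAlgebra
  let q : A →ₗ[A] B ⧸ Ideal.span {θ z} :=
    ((Ideal.span {θ z}).mkQ.restrictScalars A).comp (Algebra.linearMap A B)
  have hq : Function.Surjective q := (Submodule.mkQ_surjective _).comp hθ
  have hker : LinearMap.ker q = RingHom.ker θ ⊔ Ideal.span {z} := by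
    ext x
    have h1 : x ∈ LinearMap.ker q ↔ θ x ∈ Ideal.span {θ z} := by
      rw [LinearMap.mem_ker]
      exact Submodule.Quotient.mk_eq_zero _
    rw [h1, Ideal.mem_span_singleton', Submodule.mem_sup]
    constructor
    · rintro ⟨y, hy⟩
      obtain ⟨y, rfl⟩ := hθ y
      refine ⟨x - y * z, ?_, y * z, Ideal.mem_span_singleton'.mpr ⟨y, rfl⟩, by ring⟩
      rw [RingHom.mem_ker, map_sub, map_mul, hy, sub_self]
    · rintro ⟨u, hu, w, hw, rfl⟩
      obtain ⟨y, rfl⟩ := Ideal.mem_span_singleton'.mp hw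
      exact ⟨θ y, by rw [map_add, (RingHom.mem_ker).mp hu, zero_add, map_mul]⟩
  rw [← hker, (q.quotKerEquivOfSurjective hq).length_eq,
    Module.length_eq_of_surjective (R := B) (S := A) hθ, Ring.ord]

section Main

variable {R : Type*} [CommRing R] [IsDomain R] [Algebra ℂ R] {W : WeierstrassCurve R}
  {K : Type*} [Field K] [Algebra R K] [IsFractionRing R K]
  {σ : (W.map (algebraMap R K)).toAffine.Point} {b : R →ₐ[ℂ] ℂ}
  {P : (fibre W b).toAffine.Point}

open Classical in
/-- The generic point of the surface specialises to the point `P` of the fibre over `b`, through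
the local ring at `P`. -/
lemma specializes_genericPoint [W.IsElliptic] (hσ : σ ≠ 0) (hP : IsValueAt W σ b P) :
    ∃ v : Fin 3 → localRing W P, IsRep ((localRing W P).subtype ∘ v) (genericPoint W) ∧
      IsRep (((baseEval b).comp (restriction hσ hP)) ∘ v) P ∧
      IsRep (((baseLocalToField b K).comp (restriction hσ hP)) ∘ v) σ := by
  -- the coordinate of `P` by which to divide
  obtain ⟨j, hj, hjη⟩ : ∃ j, coords P j ≠ 0 ∧ coords (genericPoint W) j ≠ 0 := by
    rcases P with _ | ⟨x, y, h⟩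
    · refine ⟨1, one_ne_zero, ?_⟩
      change genericY W ≠ 0
      intro h0
      have hX : Affine.CoordinateRing.mk W.toAffine Polynomial.X = 0 :=
        IsFractionRing.injective W.toAffine.CoordinateRing (SurfaceField W)
          (h0.trans (map_zero _).symm)
      have := Affine.CoordinateRing.YClass_ne_zero (W' := W.toAffine) 0
      simp [Affine.CoordinateRing.YClass, hX] at this
    · exact ⟨2, one_ne_zero, one_ne_zero⟩
  have germ : ∀ i, IsGerm W P (MvPolynomial.X i) (MvPolynomial.X j)
      (coords (genericPoint W) i / coords (genericPoint W) j) := fun i =>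
    ⟨⟨1, MvPolynomial.isHomogeneous_X _ _, MvPolynomial.isHomogeneous_X _ _⟩, by simpa using hj,
      by simpa using hjη, by simp⟩
  let v : Fin 3 → localRing W P := fun i => ⟨_, _, _, germ i⟩
  refine ⟨v, ⟨_, inv_ne_zero hjη, fun i => div_eq_inv_mul _ _⟩,
    ⟨_, inv_ne_zero hj, fun i => ?_⟩, ?_⟩
  · have := baseEval_restriction hσ hP (x := v i) (germ i)
    simp only [MvPolynomial.eval₂_X] at this
    rw [inv_mul_eq_div, eq_div_iff hj]
    exact this
  · have hjσ := ((germ 0).exists_restriction hP).1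
    simp only [MvPolynomial.eval₂_X] at hjσ
    refine ⟨_, inv_ne_zero hjσ, fun i => ?_⟩
    have := restriction_spec hσ hP (x := v i) (germ i)
    simp only [MvPolynomial.eval₂_X] at this
    rw [inv_mul_eq_div, eq_div_iff hjσ]
    exact this

variable [DecidableEq K]

/-- The multiplicity of intersection of `σ` with the `n`-torsion divisor is the order of vanishing
of the coordinate `z = X / Y` of `n σ`. -/
lemma exists_torsionIntersection_eq_ord [W.IsElliptic] (hσ : ∀ n : ℕ, 0 < n → n • σ ≠ 0)
    (hP : IsValueAt W σ b P) {n : ℕ} (hn : 0 < n) (hnP : n • P = 0) :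
    ∃ z w : BaseLocalRing b, baseEval b z = 0 ∧ baseEval b w = 0 ∧ z ≠ 0 ∧
      IsRep (baseLocalToField b K ∘ ![z, 1, w]) (n • σ) ∧
      torsionIntersection W P σ n = Ring.ord (BaseLocalRing b) z := by
  classical
  have hσ0 : σ ≠ 0 := by simpa using hσ 1 one_pos
  obtain ⟨v, hv, hvP, hvσ⟩ := specializes_genericPoint hσ0 hP
  set θ := restriction hσ0 hP with hθ
  set g := (baseEval b).comp θ with hg
  have hunit : ∀ x, g x ≠ 0 → IsUnit x := isUnit_of_baseEval_restriction_ne_zero hσ0 hP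
  set W₀ := W.map (baseToLocalRing W P) with hW₀
  have hWf : W₀.map (localRing W P).subtype = W.map (baseToField W) := rfl
  have hWg : W₀.map g = fibre W b := by
    rw [hW₀, WeierstrassCurve.map_map]
    congr 1
    ext r
    simp [hg, hθ]
  have hWσ : W₀.map ((baseLocalToField b K).comp θ) = W.map (algebraMap R K) := by
    rw [hW₀, WeierstrassCurve.map_map]
    congr 1
    ext r
    simp [hθ]
  have hinj : Function.Injective (localRing W P).subtype := Subtype.val_injective
  have h1 : Specializes (localRing W P).subtype g (n • genericPoint W) (n • P) := by
    have := Specializes.nsmul hinj hunit hWf hWg ⟨v, hv, hvP⟩ n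
    convert this
  rw [hnP] at h1
  obtain ⟨z, w, hz, hw, hrep⟩ := h1.exists_isRep hunit
  have h2 : Specializes (localRing W P).subtype ((baseLocalToField b K).comp θ)
      (n • genericPoint W) (n • σ) :=
    Specializes.nsmul_of_ne_zero hinj hWf hWσ ⟨v, hv, hvσ⟩ hσ0 n
  have hrepσ : IsRep (baseLocalToField b K ∘ ![θ z, 1, θ w]) (n • σ) := by
    have := h2.isRep_of_isRep hinj hrep (j := 1) (by simp)
    convert this using 1
    funext i
    fin_cases i <;> simp
  obtain ⟨c, hc⟩ : ∃ c, w = c * z ^ 3 := exists_eq_mul_cube W₀ hunit hz hw <| by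
    have := hrep.equation
    exact (Projective.map_equation W₀.toProjective hinj _).mp this
  have hz0 : θ z ≠ 0 := by
    intro h0
    apply hσ n hn
    have : ![θ z, 1, θ w] = ![0, 1, 0] := by
      rw [hc, map_mul, map_pow, h0]
      simp
    rw [this] at hrepσ
    exact hrepσ.eq (isRep_map_zero _)
  refine ⟨θ z, θ w, hz, hw, hz0, hrepσ, ?_⟩
  have htor : torsionIdeal W P n = Ideal.span {z} := by
    obtain ⟨d, hd, hd'⟩ := hrep
    have e0 : (z : SurfaceField W) = d * coords (n • genericPoint W) 0 := hd' 0
    have e1 : (1 : SurfaceField W) = d * coords (n • genericPoint W) 1 := hd' 1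
    have e2 : (w : SurfaceField W) = d * coords (n • genericPoint W) 2 := hd' 2
    have hne : coords (n • genericPoint W) 1 ≠ 0 := right_ne_zero_of_mul (e1 ▸ one_ne_zero)
    have r0 : coords (n • genericPoint W) 0 / coords (n • genericPoint W) 1 = z := by
      rw [e0, div_eq_iff hne]
      linear_combination coords (n • genericPoint W) 0 * e1
    have r2 : coords (n • genericPoint W) 2 / coords (n • genericPoint W) 1 = w := by
      rw [e2, div_eq_iff hne]
      linear_combination coords (n • genericPoint W) 2 * e1
    rw [torsionIdeal, r0, r2]
    apply le_antisymm
    · rw [Ideal.span_le]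
      rintro x (hx | hx)
      · rw [Subtype.ext hx]
        exact Ideal.mem_span_singleton_self _
      · rw [Subtype.ext hx]
        exact Ideal.mem_span_singleton'.mpr ⟨c * z ^ 2, by rw [hc]; ring⟩
    · exact Ideal.span_mono fun x hx => Or.inl (congrArg _ hx)
  rw [torsionIntersection, htor, sectionIdeal_eq_ker hσ0 hP,
    length_quotient_ker_sup_span _ (restriction_surjective hσ0 hP)]

/-- The order of vanishing of `z (n σ)` is the same for all `n` with `n σ (b) = 0`, as it does not
change when `n` is replaced by a multiple. -/
lemma ord_eq_ord {A A' : (W.map (algebraMap R K)).toAffine.Point} {z w z' w' : BaseLocalRing b}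
    (hz : baseEval b z = 0) (hw : baseEval b w = 0)
    (hA : IsRep (baseLocalToField b K ∘ ![z, 1, w]) A)
    (hz' : baseEval b z' = 0) (hw' : baseEval b w' = 0)
    (hA' : IsRep (baseLocalToField b K ∘ ![z', 1, w']) A') {n n' : ℕ} (hn : 0 < n) (hn' : 0 < n')
    (h : n • A = n' • A') : Ring.ord (BaseLocalRing b) z = Ring.ord (BaseLocalRing b) z' := by
  have hWf : (W.map (algebraMap R (BaseLocalRing b))).map (baseLocalToField b K) =
      W.map (algebraMap R K) := by
    rw [WeierstrassCurve.map_map]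
    congr 1
    ext r
    simp
  have key : ∀ {A : (W.map (algebraMap R K)).toAffine.Point} {z w : BaseLocalRing b} {n : ℕ},
      baseEval b z = 0 → baseEval b w = 0 → IsRep (baseLocalToField b K ∘ ![z, 1, w]) A → 0 < n →
      ∃ z₁ w₁, IsRep (baseLocalToField b K ∘ ![z₁, 1, w₁]) (n • A) ∧
        Ring.ord (BaseLocalRing b) z₁ = Ring.ord (BaseLocalRing b) z := by
    intro A z w n hz hw hA hn
    obtain ⟨z₁, w₁, -, -, hrep, c, hc⟩ := exists_isRep_nsmul (baseLocalToField_injective b K)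
      (isUnit_of_baseEval_ne_zero b) hWf hz hw hA n
    refine ⟨z₁, w₁, hrep, ?_⟩
    have hu : IsUnit ((n : BaseLocalRing b) + c * z) := by
      apply isUnit_of_baseEval_ne_zero
      simpa [hz] using hn.ne'
    rw [hc, show (n : BaseLocalRing b) * z + c * z ^ 2 = (n + c * z) * z by ring,
      Ring.ord_mul_of_isUnit_left hu]
  obtain ⟨z₁, w₁, h₁, e₁⟩ := key hz hw hA hn
  obtain ⟨z₂, w₂, h₂, e₂⟩ := key hz' hw' hA' hn'
  rw [h] at h₁
  rw [← e₁, ← e₂, (isRep_unique (baseLocalToField_injective b K) h₁ h₂).1]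

/-- The value of a multiple of the section at a point of the base. -/
lemma isRep_nsmul_value {b' : R →ₐ[ℂ] ℂ} {P' : (fibre W b').toAffine.Point}
    (hP' : IsValueAt W σ b' P') {n : ℕ} {v : Fin 3 → R} (hv : IsRep (algebraMap R K ∘ v) (n • σ))
    {j : Fin 3} (hj : b' (v j) ≠ 0) : IsRep (b' ∘ v) (n • P') := by
  have hWf : (W.map (algebraMap R (BaseLocalRing b'))).map (baseLocalToField b' K) =
      W.map (algebraMap R K) := by
    rw [WeierstrassCurve.map_map]
    congr 1
    ext r
    simp
  have hWg : (W.map (algebraMap R (BaseLocalRing b'))).map (baseEval b') = fibre W b' := by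
    rw [WeierstrassCurve.map_map]
    congr 1
    ext r
    simp
  obtain ⟨u, hu, hu'⟩ := hP'
  have h1 : Specializes (baseLocalToField b' K) (baseEval b') σ P' :=
    ⟨algebraMap R _ ∘ u, by simpa [Function.comp_def, IsRep] using hu,
      by simpa [Function.comp_def, IsRep] using hu'⟩
  have h2 := h1.nsmul (baseLocalToField_injective b' K) (isUnit_of_baseEval_ne_zero b') hWf hWg n
  have h3 := h2.isRep_of_isRep (baseLocalToField_injective b' K) (v := algebraMap R _ ∘ v) (j := j)
    (by simpa [Function.comp_def] using hv) (by simpa using hj)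
  simpa [Function.comp_def] using h3

end Main

/-- The algebraic half of the theorem: the multiplicities of intersection of `σ` with all the
torsion divisors through `P` are equal to one natural number `m`, and, in terms of a local
parameter `t` of the base at `b`, the coordinate `X / Y` of a suitable multiple `n σ` is
`t ^ m r / s` with functions `r` and `s` that do not vanish at `b`. -/
lemma exists_multiplicity {R K : Type*} [CommRing R] [IsDedekindDomain R] [Algebra ℂ R]
    [Field K] [DecidableEq K] [Algebra R K] [IsFractionRing R K] {W : WeierstrassCurve R}
    [W.IsElliptic] {σ : (W.map (algebraMap R K)).toAffine.Point} {b : R →ₐ[ℂ] ℂ}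
    {P : (fibre W b).toAffine.Point} (hR : ¬ IsField R)
    (hσ : ∀ n : ℕ, 0 < n → n • σ ≠ 0) (hP : IsValueAt W σ b P)
    (htors : ∃ n : ℕ, 0 < n ∧ n • P = 0) :
    ∃ m : ℕ, (∀ n : ℕ, 0 < n → n • P = 0 → torsionIntersection W P σ n = m) ∧ 1 ≤ m ∧
      ∃ n : ℕ, 0 < n ∧ n • P = 0 ∧ ∃ t r s : R, b t = 0 ∧ b r ≠ 0 ∧ b s ≠ 0 ∧
        (∀ x, b x = 0 → ∃ y q, b q ≠ 0 ∧ q * x = t * y) ∧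
        ∀ (b' : R →ₐ[ℂ] ℂ) (P' : (fibre W b').toAffine.Point), IsValueAt W σ b' P' → b' s ≠ 0 →
          coords (n • P') 0 / coords (n • P') 1 = b' t ^ m * b' r / b' s := by
  obtain ⟨n, hn, hnP⟩ := htors
  obtain ⟨z, w, hz, hw, hz0, hrep, hlen⟩ := exists_torsionIntersection_eq_ord hσ hP hn hnP
  have hdvr : IsDiscreteValuationRing (BaseLocalRing b) :=
    IsLocalization.AtPrime.isDiscreteValuationRing_of_dedekind_domain R (ker_point_ne_bot b hR) _
  obtain ⟨p, hp⟩ := IsDiscreteValuationRing.exists_irreducible (BaseLocalRing b)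
  obtain ⟨m, u, hu⟩ := IsDiscreteValuationRing.eq_unit_mul_pow_irreducible hz0 hp
  have hord : Ring.ord (BaseLocalRing b) z = m := by
    rw [hu, Ring.ord_mul_of_isUnit_left u.isUnit,
      Ring.ord_pow (mem_nonZeroDivisors_of_ne_zero hp.ne_zero), Ring.ord_of_irreducible hp]
    simp
  refine ⟨m, fun n' hn' hnP' => ?_, ?_, n, hn, hnP, ?_⟩
  · obtain ⟨z', w', hz', hw', -, hrep', hlen'⟩ :=
      exists_torsionIntersection_eq_ord hσ hP hn' hnP'
    rw [hlen', ← hord]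
    exact ord_eq_ord hz' hw' hrep' hz hw hrep hn hn' (by rw [← mul_nsmul', ← mul_nsmul', mul_comm])
  · by_contra! hm
    obtain rfl : m = 0 := by lia
    have : baseEval b z ≠ 0 := by
      rw [hu, pow_zero, mul_one]
      exact (u.isUnit.map (baseEval b)).ne_zero
    exact this hz
  · obtain ⟨t, q, hq, ht⟩ := exists_mul_eq_algebraMap b p
    obtain ⟨q', hq'⟩ := (isUnit_algebraMap b hq).exists_right_inv
    have hp' : p = algebraMap R _ t * q' := by
      linear_combination -p * hq' + q' * ht
    have hq'u : IsUnit q' := IsUnit.of_mul_eq_one _ ((mul_comm _ _).trans hq')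
    obtain ⟨r₁, s₁, hs₁, h₁⟩ := exists_mul_eq_algebraMap b (u * q' ^ m)
    obtain ⟨r₂, s₂, hs₂, h₂⟩ := exists_mul_eq_algebraMap b w
    have hr₁ : b r₁ ≠ 0 := by
      rw [← baseEval_algebraMap, ← h₁]
      exact (((u.isUnit.mul (hq'u.pow m)).mul (isUnit_algebraMap b hs₁)).map (baseEval b)).ne_zero
    have ht0 : b t = 0 := by
      have hpe : baseEval b p = 0 := by
        by_contra h
        exact hp.not_isUnit (isUnit_of_baseEval_ne_zero b p h)
      rw [← baseEval_algebraMap, ← ht, map_mul, hpe, zero_mul]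
    refine ⟨t, r₁ * s₂, s₁ * s₂, ht0, by simpa using ⟨hr₁, hs₂⟩, by simpa using ⟨hs₁, hs₂⟩, ?_, ?_⟩
    · intro x hx
      have hmem : algebraMap R (BaseLocalRing b) x ∈ Ideal.span {p} := by
        rw [← hp.maximalIdeal_eq, IsLocalRing.mem_maximalIdeal, mem_nonunits_iff]
        intro h
        exact (h.map (baseEval b)).ne_zero (by simpa using hx)
      obtain ⟨y, hy⟩ := Ideal.mem_span_singleton'.mp hmem
      obtain ⟨y', q₂, hq₂, hy'⟩ := exists_mul_eq_algebraMap b (y * q')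
      refine ⟨y', q₂, hq₂, algebraMap_baseLocalRing_injective b ?_⟩
      rw [map_mul, map_mul, ← hy, ← hy', hp']
      ring
    · intro b' P' hP' hs'
      let v : Fin 3 → R := ![t ^ m * (r₁ * s₂), s₁ * s₂, r₂ * s₁]
      have hs0 : baseLocalToField b K (algebraMap R _ (s₁ * s₂)) ≠ 0 := by
        refine ((isUnit_algebraMap b ?_).map _).ne_zero
        simpa using ⟨hs₁, hs₂⟩
      have hv : IsRep (algebraMap R K ∘ v) (n • σ) := by
        convert hrep.smul hs0 using 1
        have e0 : algebraMap R (BaseLocalRing b) (t ^ m * (r₁ * s₂)) =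
            algebraMap R _ (s₁ * s₂) * z := by
          rw [hu, hp']
          simp only [map_mul, map_pow, mul_pow]
          linear_combination -algebraMap R (BaseLocalRing b) t ^ m * algebraMap R _ s₂ * h₁
        have e2 : algebraMap R (BaseLocalRing b) (r₂ * s₁) = algebraMap R _ (s₁ * s₂) * w := by
          simp only [map_mul]
          linear_combination -algebraMap R (BaseLocalRing b) s₁ * h₂
        funext i
        rw [Pi.smul_apply, smul_eq_mul, Function.comp_apply, Function.comp_apply, ← map_mul,
          ← baseLocalToField_algebraMap b K]
        congr 1
        fin_cases i
        · exact e0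
        · exact (mul_one _).symm
        · exact e2
      obtain ⟨c, hc, h⟩ := isRep_nsmul_value hP' hv (j := 1) hs'
      have h0 : b' (t ^ m * (r₁ * s₂)) = c * coords (n • P') 0 := h 0
      have h1 : b' (s₁ * s₂) = c * coords (n • P') 1 := h 1
      rw [← map_pow, ← map_mul, h0, h1, mul_div_mul_left _ _ hc]

end EllipticScheme

/-! ### The addition theorem for the Weierstrass function -/

namespace PeriodPair

open Filter Topology

variable (L : PeriodPair)

lemma hasDerivAt_weierstrassP {z : ℂ} (hz : z ∉ L.lattice) :
    HasDerivAt L.weierstrassP (L.derivWeierstrassP z) z := by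
  rw [← L.deriv_weierstrassP]
  exact (L.analyticOnNhd_weierstrassP z hz).differentiableAt.hasDerivAt

lemma countable_lattice : (L.lattice : Set ℂ).Countable := by
  have : Countable L.lattice := L.latticeEquivProd.toEquiv.countable_iff.mpr inferInstance
  exact Set.to_countable _

lemma isPreconnected_compl_lattice : IsPreconnected (L.lattice : Set ℂ)ᶜ :=
  (L.countable_lattice.isConnected_compl_of_one_lt_rank (by simp)).isPreconnected

lemma eventually_notMem_lattice : ∀ᶠ z in 𝓝[≠] (0 : ℂ), z ∉ L.lattice := by
  filter_upwards [self_mem_nhdsWithin,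
    mem_nhdsWithin_of_mem_nhds (L.compl_lattice_sdiff_singleton_mem_nhds 0)] with z hz hz' h
  exact hz' ⟨h, hz⟩

lemma eventually_notMem_lattice' {a : ℂ} (ha : a ∉ L.lattice) : ∀ᶠ z in 𝓝 a, z ∉ L.lattice :=
  L.isClosed_lattice.isOpen_compl.mem_nhds ha

lemma tendsto_weierstrassP_cobounded :
    Tendsto L.weierstrassP (𝓝[≠] 0) (Bornology.cobounded ℂ) := by
  rw [tendsto_cobounded_iff_meromorphicOrderAt_neg (L.meromorphic_weierstrassP 0),
    L.order_weierstrassP 0 (zero_mem _)]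
  exact WithTop.coe_lt_coe.mpr (by norm_num : (-2 : ℤ) < 0)

lemma tendsto_inv_weierstrassP : Tendsto (fun z => (L.weierstrassP z)⁻¹) (𝓝[≠] 0) (𝓝 0) :=
  tendsto_inv₀_cobounded.comp L.tendsto_weierstrassP_cobounded

lemma eventually_lt_norm_weierstrassP (r : ℝ) :
    ∀ᶠ z in 𝓝[≠] (0 : ℂ), r < ‖L.weierstrassP z‖ :=
  (tendsto_norm_cobounded_atTop.comp L.tendsto_weierstrassP_cobounded).eventually_gt_atTop r

/-- Having a pole, `℘` is not constant. -/
lemma not_forall_weierstrassP_eq (c : ℂ) : ¬ ∀ z ∉ L.lattice, L.weierstrassP z = c := by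
  intro h
  obtain ⟨z, hz, hz'⟩ :=
    (L.eventually_notMem_lattice.and (L.eventually_lt_norm_weierstrassP ‖c‖)).exists
  rw [h z hz] at hz'
  exact lt_irrefl _ hz'

/-- The values of `℘` are isolated. -/
lemma eventually_weierstrassP_ne {a : ℂ} (ha : a ∉ L.lattice) :
    ∀ᶠ z in 𝓝[≠] a, L.weierstrassP z ≠ L.weierstrassP a := by
  by_contra h
  refine L.not_forall_weierstrassP_eq (L.weierstrassP a) fun z hz => ?_
  refine L.analyticOnNhd_weierstrassP.eqOn_of_preconnected_of_frequently_eq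
    (analyticOnNhd_const (v := L.weierstrassP a)) L.isPreconnected_compl_lattice ha ?_ hz
  exact h

/-- The differential equation `℘'' = 6 ℘ ^ 2 - g₂ / 2`. -/
lemma hasDerivAt_derivWeierstrassP {z : ℂ} (hz : z ∉ L.lattice) :
    HasDerivAt L.derivWeierstrassP (6 * L.weierstrassP z ^ 2 - L.g₂ / 2) z := by
  have hopen : IsOpen (L.lattice : Set ℂ)ᶜ := L.isClosed_lattice.isOpen_compl
  have hd : ∀ z ∉ L.lattice, HasDerivAt L.derivWeierstrassP (deriv L.derivWeierstrassP z) z :=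
    fun z hz => (L.analyticOnNhd_derivWeierstrassP z hz).differentiableAt.hasDerivAt
  -- Differentiate the equation for `℘' ^ 2` and divide by `℘'`, which does not vanish identically.
  have key : ∀ z ∈ (L.lattice : Set ℂ)ᶜ, L.derivWeierstrassP z *
      (deriv L.derivWeierstrassP z - (6 * L.weierstrassP z ^ 2 - L.g₂ / 2)) = 0 := by
    intro z hz
    have h1 := (hd z hz).pow 2
    have h2 := ((((L.hasDerivAt_weierstrassP hz).pow 3).const_mul 4).sub
      ((L.hasDerivAt_weierstrassP hz).const_mul L.g₂)).sub_const L.g₃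
    have h3 : (fun z => L.derivWeierstrassP z ^ 2) =ᶠ[𝓝 z]
        fun z => 4 * L.weierstrassP z ^ 3 - L.g₂ * L.weierstrassP z - L.g₃ := by
      filter_upwards [L.eventually_notMem_lattice' hz] with w hw
      exact L.derivWeierstrassP_sq w hw
    have h4 := h1.unique (h2.congr_of_eventuallyEq h3)
    simp only [Nat.cast_ofNat, Nat.reduceSub, pow_one] at h4
    linear_combination h4 / 2
  rcases AnalyticOnNhd.eq_zero_or_eq_zero_of_mul_eq_zero L.analyticOnNhd_derivWeierstrassP
    (L.analyticOnNhd_derivWeierstrassP.deriv.sub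
      ((analyticOnNhd_const.mul (L.analyticOnNhd_weierstrassP.pow 2)).sub analyticOnNhd_const))
    key L.isPreconnected_compl_lattice with h | h
  · refine absurd (fun w hw => ?_) (L.not_forall_weierstrassP_eq (L.weierstrassP z))
    refine hopen.is_const_of_deriv_eq_zero L.isPreconnected_compl_lattice
      L.differentiableOn_weierstrassP (fun x hx => ?_) hw hz
    rw [L.deriv_weierstrassP]
    exact h x hx
  · have := hd z hz
    rwa [sub_eq_zero.mp (h z hz)] at this

section Addition

variable {c : ℂ}

/-- The right-hand side of the addition formula for `℘ (z + (c - z))`. -/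
def chordX (c z : ℂ) : ℂ :=
  ((L.derivWeierstrassP z - L.derivWeierstrassP (c - z)) /
    (L.weierstrassP z - L.weierstrassP (c - z))) ^ 2 / 4 -
    L.weierstrassP z - L.weierstrassP (c - z)

/-- By the differential equation, the `x`-coordinate of the sum of the points with parameters `z`
and `c - z` does not vary with `z`. -/
lemma hasDerivAt_chordX {z : ℂ} (hz : z ∉ L.lattice) (hcz : c - z ∉ L.lattice)
    (hne : L.weierstrassP z ≠ L.weierstrassP (c - z)) : HasDerivAt (L.chordX c) 0 z := by
  have hs : HasDerivAt (fun z => c - z) (-1) z := by simpa using (hasDerivAt_id z).const_sub c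
  have hp := L.hasDerivAt_weierstrassP hz
  have hp' := L.hasDerivAt_derivWeierstrassP hz
  have hq := (L.hasDerivAt_weierstrassP hcz).comp z hs
  have hq' := (L.hasDerivAt_derivWeierstrassP hcz).comp z hs
  have hD := sub_ne_zero.mpr hne
  have h := (((((hp'.sub hq').div (hp.sub hq) hD).pow 2).div_const 4).sub hp).sub hq
  refine HasDerivAt.congr_deriv (f := L.chordX c) h ?_
  have e1 := L.derivWeierstrassP_sq z hz
  have e2 := L.derivWeierstrassP_sq _ hcz
  simp only [Pi.sub_apply, Function.comp_apply, Pi.div_apply, Nat.cast_ofNat, Nat.reduceSub,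
    pow_one]
  set p := L.weierstrassP z
  set q := L.weierstrassP (c - z)
  set p' := L.derivWeierstrassP z
  set q' := L.derivWeierstrassP (c - z)
  field_simp
  linear_combination -2 * (p' - q') * (e1 - e2)

/-- The constant value of `chordX` is found by letting one of the two points tend to the origin.
Dividing by `℘ z ^ 2` leaves only bounded terms, since `℘' z / ℘ z ^ 2` tends to `0`. -/
lemma tendsto_chordX (hc : c ∉ L.lattice) :
    Tendsto (L.chordX c) (𝓝[≠] 0) (𝓝 (L.weierstrassP c)) := by
  have hs : Tendsto (fun z : ℂ => c - z) (𝓝[≠] 0) (𝓝 c) := by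
    have : ContinuousAt (fun z : ℂ => c - z) 0 := by fun_prop
    simpa [ContinuousAt] using this.tendsto.mono_left nhdsWithin_le_nhds
  have hq := (L.analyticOnNhd_weierstrassP c hc).continuousAt.tendsto.comp hs
  have hq' := (L.analyticOnNhd_derivWeierstrassP c hc).continuousAt.tendsto.comp hs
  have he := L.tendsto_inv_weierstrassP
  have hr : Tendsto (fun z => L.derivWeierstrassP z * (L.weierstrassP z)⁻¹ ^ 2)
      (𝓝[≠] 0) (𝓝 0) := by
    have h1 : Tendsto (fun z => 4 * (L.weierstrassP z)⁻¹ - L.g₂ * (L.weierstrassP z)⁻¹ ^ 3 -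
        L.g₃ * (L.weierstrassP z)⁻¹ ^ 4) (𝓝[≠] 0) (𝓝 0) := by
      have := ((he.const_mul 4).sub ((he.pow 3).const_mul L.g₂)).sub ((he.pow 4).const_mul L.g₃)
      simpa using this
    have h2 : Tendsto (fun z => (L.derivWeierstrassP z * (L.weierstrassP z)⁻¹ ^ 2) ^ 2)
        (𝓝[≠] 0) (𝓝 0) := by
      refine h1.congr' ?_
      filter_upwards [L.eventually_notMem_lattice, L.eventually_lt_norm_weierstrassP 0]
        with z hz hz'
      have hz0 : L.weierstrassP z ≠ 0 := norm_pos_iff.mp hz'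
      rw [mul_pow, L.derivWeierstrassP_sq z hz]
      field_simp
    rw [tendsto_zero_iff_norm_tendsto_zero] at h2 ⊢
    have h3 := h2.sqrt
    simp only [norm_pow _ 2, Real.sqrt_zero] at h3
    exact h3.congr fun z => Real.sqrt_sq (norm_nonneg _)
  have hlim : Tendsto (fun z => (4 * L.weierstrassP (c - z)
      + 4 * L.weierstrassP (c - z) ^ 2 * (L.weierstrassP z)⁻¹
      + (L.derivWeierstrassP (c - z) ^ 2 - 4 * L.weierstrassP (c - z) ^ 3 - L.g₃)
        * (L.weierstrassP z)⁻¹ ^ 2 - L.g₂ * (L.weierstrassP z)⁻¹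
      - 2 * (L.derivWeierstrassP z * (L.weierstrassP z)⁻¹ ^ 2) * L.derivWeierstrassP (c - z)) /
      (4 * (1 - L.weierstrassP (c - z) * (L.weierstrassP z)⁻¹) ^ 2))
      (𝓝[≠] 0) (𝓝 (L.weierstrassP c)) := by
    have hnum := ((((hq.const_mul 4).add (((hq.pow 2).const_mul 4).mul he)).add
      ((((hq'.pow 2).sub ((hq.pow 3).const_mul 4)).sub_const L.g₃).mul (he.pow 2))).sub
        (he.const_mul L.g₂)).sub ((hr.const_mul 2).mul hq')
    have hden := (((hq.mul he).const_sub 1).pow 2).const_mul 4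
    have := hnum.div hden (by simp)
    rw [show L.weierstrassP c = (4 * L.weierstrassP c + 4 * L.weierstrassP c ^ 2 * 0 +
      (L.derivWeierstrassP c ^ 2 - 4 * L.weierstrassP c ^ 3 - L.g₃) * 0 ^ 2 - L.g₂ * 0 -
      2 * 0 * L.derivWeierstrassP c) / (4 * (1 - L.weierstrassP c * 0) ^ 2) by simp]
    exact this
  have hne : Tendsto (fun z => L.weierstrassP (c - z) * (L.weierstrassP z)⁻¹) (𝓝[≠] 0) (𝓝 0) := by
    have := hq.mul he
    rw [mul_zero] at this
    exact this
  refine hlim.congr' ?_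
  filter_upwards [L.eventually_notMem_lattice, L.eventually_lt_norm_weierstrassP 0,
    hne.eventually_ne zero_ne_one] with z hz hz' hh
  have hz0 : L.weierstrassP z ≠ 0 := norm_pos_iff.mp hz'
  have e1 := L.derivWeierstrassP_sq z hz
  rw [chordX]
  set p := L.weierstrassP z
  set q := L.weierstrassP (c - z)
  set p' := L.derivWeierstrassP z
  set q' := L.derivWeierstrassP (c - z)
  have hpq : p - q ≠ 0 := by
    intro h
    rw [← sub_eq_zero.mp h, mul_inv_cancel₀ hz0] at hh
    exact hh rfl
  have h1 : 1 - q * p⁻¹ = (p - q) / p := by field_simp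
  rw [h1]
  field_simp
  linear_combination (-1) * e1

end Addition

/-- For small `z ≠ 0` the points with parameters `z` and `c - z` are in general position: `℘ z` is
large, while `℘ (c - z)` stays bounded. -/
lemma eventually_weierstrassP_ne_sub {c : ℂ} (hc : c ∉ L.lattice) :
    ∀ᶠ z in 𝓝[≠] (0 : ℂ), z ∉ L.lattice ∧ c - z ∉ L.lattice ∧
      L.weierstrassP z ≠ L.weierstrassP (c - z) := by
  have hs : Tendsto (fun z : ℂ => c - z) (𝓝[≠] 0) (𝓝 c) := by
    have : ContinuousAt (fun z : ℂ => c - z) 0 := by fun_prop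
    simpa [ContinuousAt] using this.tendsto.mono_left nhdsWithin_le_nhds
  have hq := ((L.analyticOnNhd_weierstrassP c hc).continuousAt.tendsto.comp hs).norm
  filter_upwards [L.eventually_notMem_lattice, hs.eventually (L.eventually_notMem_lattice' hc),
    L.eventually_lt_norm_weierstrassP (‖L.weierstrassP c‖ + 1),
    hq.eventually_lt_const (lt_add_one _)] with z h1 h2 h3 h4
  refine ⟨h1, h2, fun h => ?_⟩
  rw [h] at h3
  exact lt_asymm h3 h4

/-- The addition formula near `0`: `chordX` extends over `0` to a function on a disc with zero
derivative. -/
lemma eventually_chordX_eq {c : ℂ} (hc : c ∉ L.lattice) :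
    ∀ᶠ z in 𝓝[≠] (0 : ℂ), L.chordX c z = L.weierstrassP c := by
  obtain ⟨r, hr, hball⟩ := Metric.mem_nhdsWithin_iff.mp (L.eventually_weierstrassP_ne_sub hc)
  have hd : ∀ z ∈ Metric.ball (0 : ℂ) r \ {0}, HasDerivAt (L.chordX c) 0 z := fun z hz =>
    let ⟨h1, h2, h3⟩ := hball hz
    L.hasDerivAt_chordX h1 h2 h3
  set f := Function.update (L.chordX c) 0 (L.weierstrassP c) with hf
  have hfeq : ∀ z ≠ 0, f =ᶠ[𝓝 z] L.chordX c := fun z hz => by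
    filter_upwards [isOpen_ne.mem_nhds hz] with w hw
    exact Function.update_of_ne hw _ _
  have hd' : ∀ z ∈ Metric.ball (0 : ℂ) r \ {0}, HasDerivAt f 0 z := fun z hz =>
    (hd z hz).congr_of_eventuallyEq (hfeq z hz.2)
  have hdiff : DifferentiableOn ℂ f (Metric.ball 0 r) := by
    refine (Complex.differentiableOn_compl_singleton_and_continuousAt_iff
      (Metric.ball_mem_nhds 0 hr)).mp
        ⟨fun z hz => (hd' z hz).differentiableAt.differentiableWithinAt,
      ?_⟩
    exact continuousAt_update_same.mpr (L.tendsto_chordX hc)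
  have hderiv : ∀ z ∈ Metric.ball (0 : ℂ) r, deriv f z = 0 := by
    intro z hz
    by_cases h0 : z = 0
    · subst h0
      have hcont := ((hdiff.analyticOnNhd Metric.isOpen_ball).deriv 0 hz).continuousAt
      have h1 : Tendsto (deriv f) (𝓝[≠] 0) (𝓝 0) := by
        refine tendsto_const_nhds.congr' ?_
        filter_upwards [self_mem_nhdsWithin, mem_nhdsWithin_of_mem_nhds
          (Metric.ball_mem_nhds 0 hr)] with w hw hw'
        exact (hd' w ⟨hw', hw⟩).deriv.symm
      exact tendsto_nhds_unique (hcont.tendsto.mono_left nhdsWithin_le_nhds) h1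
    · exact (hd' z ⟨hz, h0⟩).deriv
  filter_upwards [self_mem_nhdsWithin, mem_nhdsWithin_of_mem_nhds (Metric.ball_mem_nhds 0 hr)]
    with z hz hz'
  have := Metric.isOpen_ball.is_const_of_deriv_eq_zero
    (convex_ball (0 : ℂ) r).isPreconnected hdiff hderiv hz' (Metric.mem_ball_self hr)
  rwa [hf, Function.update_of_ne hz, Function.update_self] at this

/-- The addition theorem for `℘`, with denominators cleared. It is propagated from small `a`, with
`c = a + b` fixed, by the identity theorem on the plane without a countable set. -/
lemma weierstrassP_add_aux {a b : ℂ} (ha : a ∉ L.lattice) (hb : b ∉ L.lattice)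
    (hab : a + b ∉ L.lattice) :
    (L.derivWeierstrassP a - L.derivWeierstrassP b) ^ 2 =
      4 * (L.weierstrassP (a + b) + L.weierstrassP a + L.weierstrassP b) *
        (L.weierstrassP a - L.weierstrassP b) ^ 2 := by
  set c := a + b with hc
  set U : Set ℂ := ((L.lattice : Set ℂ) ∪ (fun z => c - z) '' L.lattice)ᶜ with hU
  have hmem : ∀ z, z ∈ U ↔ z ∉ L.lattice ∧ c - z ∉ L.lattice := by
    intro z
    simp only [hU, Set.mem_compl_iff, Set.mem_union, SetLike.mem_coe, Set.mem_image, not_or]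
    refine and_congr_right fun _ => not_congr ⟨?_, fun h => ⟨_, h, by ring⟩⟩
    rintro ⟨w, hw, rfl⟩
    simpa using hw
  have hconn : IsPreconnected U :=
    ((L.countable_lattice.union (L.countable_lattice.image _)).isConnected_compl_of_one_lt_rank
      (by simp)).isPreconnected
  have hp : AnalyticOnNhd ℂ L.weierstrassP U := fun z hz =>
    L.analyticOnNhd_weierstrassP z ((hmem z).mp hz).1
  have hp' : AnalyticOnNhd ℂ L.derivWeierstrassP U := fun z hz =>
    L.analyticOnNhd_derivWeierstrassP z ((hmem z).mp hz).1
  have hs : ∀ z, AnalyticAt ℂ (fun z => c - z) z := fun z => by fun_prop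
  have hq : AnalyticOnNhd ℂ (fun z => L.weierstrassP (c - z)) U := fun z hz =>
    AnalyticAt.fun_comp (L.analyticOnNhd_weierstrassP _ ((hmem z).mp hz).2) (hs z)
  have hq' : AnalyticOnNhd ℂ (fun z => L.derivWeierstrassP (c - z)) U := fun z hz =>
    AnalyticAt.fun_comp (L.analyticOnNhd_derivWeierstrassP _ ((hmem z).mp hz).2) (hs z)
  have hev : ∀ᶠ z in 𝓝[≠] (0 : ℂ), z ∈ U ∧
      (L.derivWeierstrassP z - L.derivWeierstrassP (c - z)) ^ 2 =
      4 * (L.weierstrassP c + L.weierstrassP z + L.weierstrassP (c - z)) *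
        (L.weierstrassP z - L.weierstrassP (c - z)) ^ 2 := by
    filter_upwards [L.eventually_chordX_eq hab, L.eventually_weierstrassP_ne_sub hab]
      with z h1 h2
    refine ⟨(hmem z).mpr ⟨h2.1, h2.2.1⟩, ?_⟩
    rw [← h1, chordX]
    have := sub_ne_zero.mpr h2.2.2
    field_simp
    ring
  obtain ⟨z₀, ⟨hz₀, -⟩, hz₀', hne⟩ := (hev.and ((eventually_nhdsWithin_of_eventually_nhds
    (eventually_eventually_nhds.mpr (eventually_nhdsWithin_iff.mp hev))).and
    self_mem_nhdsWithin)).exists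
  have hfin : (fun z => (L.derivWeierstrassP z - L.derivWeierstrassP (c - z)) ^ 2) =ᶠ[𝓝 z₀]
      fun z => 4 * (L.weierstrassP c + L.weierstrassP z + L.weierstrassP (c - z)) *
        (L.weierstrassP z - L.weierstrassP (c - z)) ^ 2 := by
    filter_upwards [hz₀', isOpen_ne.mem_nhds hne] with z h1 h2
    exact (h1 h2).2
  have := ((hp'.sub hq').pow 2).eqOn_of_preconnected_of_eventuallyEq
    ((analyticOnNhd_const.mul ((analyticOnNhd_const.add hp).add hq)).mul ((hp.sub hq).pow 2))
    hconn hz₀ hfin ((hmem a).mpr ⟨ha, by rwa [hc, add_sub_cancel_left]⟩)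
  simpa only [hc, Pi.sub_apply, Pi.add_apply, Pi.mul_apply, Pi.pow_apply, add_sub_cancel_left]
    using this

/-- If `a + b` is a period then `b` is congruent to `-a`, and `℘` is even. -/
lemma weierstrassP_eq_of_add_mem {a b : ℂ} (hab : a + b ∈ L.lattice) :
    L.weierstrassP a = L.weierstrassP b := by
  have h := L.weierstrassP_add_coe (-a) ⟨a + b, hab⟩
  rw [L.weierstrassP_neg] at h
  simpa using h.symm

/-- The slope of the chord through the points with parameters `a` and `b`. -/
def chordSlope (a b : ℂ) : ℂ :=
  (L.derivWeierstrassP a - L.derivWeierstrassP b) / (L.weierstrassP a - L.weierstrassP b)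

/-- The addition theorem for `℘`. -/
lemma weierstrassP_add {a b : ℂ} (ha : a ∉ L.lattice) (hb : b ∉ L.lattice)
    (hne : L.weierstrassP a ≠ L.weierstrassP b) :
    L.weierstrassP (a + b) =
      L.chordSlope a b ^ 2 / 4 - L.weierstrassP a - L.weierstrassP b := by
  have := L.weierstrassP_add_aux ha hb fun h => hne (L.weierstrassP_eq_of_add_mem h)
  have hD := sub_ne_zero.mpr hne
  rw [chordSlope]
  field_simp
  linear_combination -this

/-- The addition theorem for `℘'`, obtained by differentiating the one for `℘`. -/
lemma derivWeierstrassP_add {a b : ℂ} (ha : a ∉ L.lattice) (hb : b ∉ L.lattice)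
    (hne : L.weierstrassP a ≠ L.weierstrassP b) :
    L.derivWeierstrassP (a + b) = -(L.derivWeierstrassP a +
      L.chordSlope a b * (L.weierstrassP (a + b) - L.weierstrassP a)) := by
  have hab : a + b ∉ L.lattice := fun h => hne (L.weierstrassP_eq_of_add_mem h)
  have hp := L.hasDerivAt_weierstrassP ha
  have hp' := L.hasDerivAt_derivWeierstrassP ha
  have hD := sub_ne_zero.mpr hne
  have hl := (L.hasDerivAt_weierstrassP hab).comp_add_const a b
  have hr := (((((hp'.sub_const (L.derivWeierstrassP b)).div
    (hp.sub_const (L.weierstrassP b)) hD).pow 2).div_const 4).sub hp).sub_const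
      (L.weierstrassP b)
  have heq : (fun x => L.weierstrassP (x + b)) =ᶠ[𝓝 a] fun x =>
      ((L.derivWeierstrassP x - L.derivWeierstrassP b) /
        (L.weierstrassP x - L.weierstrassP b)) ^ 2 / 4 - L.weierstrassP x - L.weierstrassP b := by
    filter_upwards [L.eventually_notMem_lattice' ha, hp.continuousAt.eventually_ne hne]
      with x h1 h2
    exact L.weierstrassP_add h1 hb h2
  have := hl.unique (hr.congr_of_eventuallyEq heq)
  rw [this, L.weierstrassP_add ha hb hne, chordSlope]
  have e1 := L.derivWeierstrassP_sq a ha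
  have e2 := L.derivWeierstrassP_sq b hb
  simp only [Pi.div_apply, Nat.cast_ofNat, Nat.reduceSub, pow_one]
  set p := L.weierstrassP a
  set q := L.weierstrassP b
  set p' := L.derivWeierstrassP a
  set q' := L.derivWeierstrassP b
  field_simp
  linear_combination -(p' - q') * (e1 - e2)

end PeriodPair

/-! ### The elliptic exponential is a homomorphism -/

namespace EllipticScheme

open Filter Topology

variable {W : WeierstrassCurve ℂ} [W.IsElliptic] {L : PeriodPair} (hL : IsPeriodPairOf W L)

lemma ellipticExp_of_mem {z : ℂ} (hz : z ∈ L.lattice) : ellipticExp W L hL z = 0 := by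
  rw [ellipticExp, dif_pos hz]

lemma ellipticExp_eq_zero_iff {z : ℂ} : ellipticExp W L hL z = 0 ↔ z ∈ L.lattice := by
  refine ⟨fun h => ?_, ellipticExp_of_mem hL⟩
  by_contra hz
  rw [ellipticExp, dif_neg hz] at h
  exact WeierstrassCurve.Affine.Point.some_ne_zero _ h

lemma ellipticExp_neg (z : ℂ) : ellipticExp W L hL (-z) = -ellipticExp W L hL z := by
  by_cases hz : z ∈ L.lattice
  · rw [ellipticExp_of_mem hL hz, ellipticExp_of_mem hL (neg_mem hz), neg_zero]
  · have hz' : -z ∉ L.lattice := fun h => hz (by simpa using neg_mem h)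
    rw [ellipticExp, ellipticExp, dif_neg hz, dif_neg hz', WeierstrassCurve.Affine.Point.neg_some,
      WeierstrassCurve.Affine.Point.some.injEq, WeierstrassCurve.Affine.negY, L.weierstrassP_neg,
      L.derivWeierstrassP_neg]
    exact ⟨rfl, by ring⟩

lemma ellipticExp_add_of_mem (z : ℂ) {l : ℂ} (hl : l ∈ L.lattice) :
    ellipticExp W L hL (z + l) = ellipticExp W L hL z := by
  by_cases hz : z ∈ L.lattice
  · rw [ellipticExp_of_mem hL hz, ellipticExp_of_mem hL (add_mem hz hl)]
  · have hz' : z + l ∉ L.lattice := fun h => hz (by simpa using sub_mem h hl)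
    have h1 := L.weierstrassP_add_coe z ⟨l, hl⟩
    have h2 := L.derivWeierstrassP_add_coe z ⟨l, hl⟩
    simp only at h1 h2
    simp only [ellipticExp, dif_neg hz, dif_neg hz', h1, h2]

lemma ellipticExp_add_of_ne {a b : ℂ} (ha : a ∉ L.lattice) (hb : b ∉ L.lattice)
    (hne : L.weierstrassP a ≠ L.weierstrassP b) :
    ellipticExp W L hL (a + b) = ellipticExp W L hL a + ellipticExp W L hL b := by
  have hab : a + b ∉ L.lattice := fun h => hne (L.weierstrassP_eq_of_add_mem h)
  have hx : L.weierstrassP a - W.b₂ / 12 ≠ L.weierstrassP b - W.b₂ / 12 := fun h =>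
    hne (sub_left_injective h)
  have hD := sub_ne_zero.mpr hne
  rw [ellipticExp, ellipticExp, ellipticExp, dif_neg ha, dif_neg hb, dif_neg hab,
    WeierstrassCurve.Affine.Point.add_some (fun h => hx h.1),
    WeierstrassCurve.Affine.Point.some.injEq, WeierstrassCurve.Affine.slope_of_X_ne hx]
  have hm : ((L.derivWeierstrassP a - W.a₁ * (L.weierstrassP a - W.b₂ / 12) - W.a₃) / 2 -
      (L.derivWeierstrassP b - W.a₁ * (L.weierstrassP b - W.b₂ / 12) - W.a₃) / 2) /
      (L.weierstrassP a - W.b₂ / 12 - (L.weierstrassP b - W.b₂ / 12)) =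
      (L.chordSlope a b - W.a₁) / 2 := by
    rw [PeriodPair.chordSlope, sub_sub_sub_cancel_right]
    field_simp
    ring
  rw [hm]
  have e : W.b₂ = W.a₁ ^ 2 + 4 * W.a₂ := rfl
  have hX : L.weierstrassP (a + b) - W.b₂ / 12 = W.toAffine.addX (L.weierstrassP a - W.b₂ / 12)
      (L.weierstrassP b - W.b₂ / 12) ((L.chordSlope a b - W.a₁) / 2) := by
    rw [WeierstrassCurve.Affine.addX, L.weierstrassP_add ha hb hne]
    linear_combination (-1 / 4 : ℂ) * e
  refine ⟨hX, ?_⟩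
  rw [WeierstrassCurve.Affine.addY, WeierstrassCurve.Affine.negAddY,
    WeierstrassCurve.Affine.negY, ← hX, L.derivWeierstrassP_add ha hb hne]
  ring

/-- The elliptic exponential is a homomorphism. When the chord through the two points is vertical
or not defined, the points are moved into general position by an auxiliary small parameter. -/
lemma ellipticExp_add (a b : ℂ) :
    ellipticExp W L hL (a + b) = ellipticExp W L hL a + ellipticExp W L hL b := by
  by_cases ha : a ∈ L.lattice
  · rw [add_comm a, ellipticExp_add_of_mem hL b ha, ellipticExp_of_mem hL ha, zero_add]
  by_cases hb : b ∈ L.lattice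
  · rw [ellipticExp_add_of_mem hL a hb, ellipticExp_of_mem hL hb, add_zero]
  by_cases hab : a + b ∈ L.lattice
  · have h := ellipticExp_add_of_mem hL (-a) hab
    rw [neg_add_cancel_left, ellipticExp_neg] at h
    rw [ellipticExp_of_mem hL hab, h, add_neg_cancel]
  by_cases hne : L.weierstrassP a = L.weierstrassP b
  swap
  · exact ellipticExp_add_of_ne hL ha hb hne
  have hs : Tendsto (fun s : ℂ => a - s) (𝓝[≠] 0) (𝓝[≠] a) := by
    refine tendsto_nhdsWithin_of_tendsto_nhds_of_eventually_within _ ?_ ?_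
    · have : ContinuousAt (fun z : ℂ => a - z) 0 := by fun_prop
      simpa [ContinuousAt] using this.tendsto.mono_left nhdsWithin_le_nhds
    · filter_upwards [self_mem_nhdsWithin] with s hs
      simpa using hs
  -- With `t = s - a` the three sums `a + t = s`, `b + (-t) = a + b - s` and `s + (a + b - s)`
  -- are covered by the generic case, and together they give the claim.
  obtain ⟨s, ⟨h1, h2, h3⟩, h4, h5⟩ := ((L.eventually_weierstrassP_ne_sub hab).and
    ((hs.eventually (L.eventually_weierstrassP_ne ha)).and
      (hs.eventually (eventually_nhdsWithin_of_eventually_nhds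
        (L.eventually_notMem_lattice' ha))))).exists
  have h5' : -(a - s) ∉ L.lattice := fun h => h5 (by simpa using neg_mem h)
  have e1 := ellipticExp_add_of_ne hL ha h5' (by rw [L.weierstrassP_neg]; exact h4.symm)
  have e2 := ellipticExp_add_of_ne hL hb h5 (by rw [← hne]; exact h4.symm)
  have e3 := ellipticExp_add_of_ne hL h1 h2 h3
  rw [add_sub_cancel] at e3
  rw [show a + -(a - s) = s by ring, ellipticExp_neg] at e1
  rw [show b + (a - s) = a + b - s by ring] at e2
  rw [e3, e1, e2]
  abel

lemma nsmul_ellipticExp (n : ℕ) (z : ℂ) :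
    n • ellipticExp W L hL z = ellipticExp W L hL (n * z) := by
  induction n with
  | zero => simp [ellipticExp_of_mem hL (zero_mem _)]
  | succ n ih => rw [succ_nsmul, ih, ← ellipticExp_add]; push_cast; ring_nf

end EllipticScheme

/-! ### The order of growth of an analytic map -/

namespace EllipticScheme

open Filter Topology Asymptotics

section Multiplicity

variable {E F : Type*} [NormedAddCommGroup E] [NormedSpace ℝ E] [NormedAddCommGroup F]
  [NormedSpace ℝ F]

/-- The `k`-th derivative of an analytic function vanishes if and only if the homogeneous part of
degree `k` of its power series does. -/
lemma iteratedFDeriv_eq_zero_iff [CompleteSpace F] {f : E → F}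
    {p : FormalMultilinearSeries ℝ E F} {x : E} (h : HasFPowerSeriesAt f p x) (k : ℕ) :
    iteratedFDeriv ℝ k f x = 0 ↔ ∀ y, (p k fun _ => y) = 0 := by
  obtain ⟨r, hr⟩ := h
  refine ⟨fun h0 y => ?_, fun h0 => ?_⟩
  · have := hr.iteratedFDeriv_eq_sum_of_completeSpace (n := k) (fun _ => y)
    rw [h0] at this
    simp only [zero_apply, Finset.sum_const, Finset.card_univ] at this
    rw [← Nat.cast_smul_eq_nsmul ℝ] at this
    rcases smul_eq_zero.mp this.symm with h1 | h1
    · exact absurd h1 (Nat.cast_ne_zero.mpr Fintype.card_ne_zero)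
    · exact h1
  · ext v
    rw [hr.iteratedFDeriv_eq_sum_of_completeSpace,
      ← ContinuousMultilinearMap.iteratedFDeriv_comp_diagonal (p k) x v]
    simp only [h0, zero_apply]
    rw [iteratedFDeriv_fun_zero]
    rfl

/-- An analytic function is `f x + O(‖y‖ ^ k)` if its homogeneous parts of degrees `1, …, k - 1`
vanish. -/
lemma isBigO_sub_of_forall_eq_zero {f : E → F} {p : FormalMultilinearSeries ℝ E F} {x : E}
    (h : HasFPowerSeriesAt f p x) {k : ℕ}
    (h0 : ∀ j, 1 ≤ j → j < k → ∀ y, (p j fun _ => y) = 0) :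
    (fun y => f (x + y) - f x) =O[𝓝 0] fun y => ‖y‖ ^ k := by
  rcases Nat.eq_zero_or_pos k with rfl | hk
  · have hc : ContinuousAt (fun y => f (x + y) - f x) 0 := by
      have : ContinuousAt f (x + 0) := by rw [add_zero]; exact h.continuousAt
      exact (ContinuousAt.comp (f := fun y => x + y) this (by fun_prop)).sub continuousAt_const
    simpa using hc.norm.isBoundedUnder_le.isBigO_one ℝ
  · refine (h.isBigO_sub_partialSum_pow k).congr_left fun y => ?_
    rw [FormalMultilinearSeries.partialSum, Finset.sum_eq_single_of_mem 0 (by simpa using hk),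
      h.coeff_zero]
    intro j hj hj0
    exact h0 j (by omega) (by simpa using hj) y

/-- If `f (x + y) - f x` is exactly of the order of `‖y‖ ^ m`, then `m` is the least positive order
of a nonzero derivative of `f` at `x`. -/
lemma isLeast_iteratedFDeriv_ne_zero [Nontrivial E] [CompleteSpace F] {f : E → F} {x : E}
    (hf : AnalyticAt ℝ f x)
    {m : ℕ} (hm : 1 ≤ m) (hO : (fun y => f (x + y) - f x) =O[𝓝 0] fun y => ‖y‖ ^ m)
    (hΩ : (fun y => ‖y‖ ^ m) =O[𝓝 (0 : E)] fun y => f (x + y) - f x) :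
    IsLeast {k : ℕ | 1 ≤ k ∧ iteratedFDeriv ℝ k f x ≠ 0} m := by
  obtain ⟨p, hp⟩ := hf
  have hlow : ∀ k, 1 ≤ k → k < m → ∀ y, (p k fun _ => y) = 0 := by
    intro k
    induction k using Nat.strong_induction_on with
    | _ k ih =>
      intro hk hkm y
      refine IsBigO.continuousMultilinearMap_apply_eq_zero ?_ y
      have h1 : (fun y : E => ‖y‖ ^ m) =O[𝓝 0] fun y => ‖y‖ ^ (k + 1) := by
        refine IsBigO.of_bound 1 ?_
        filter_upwards [Metric.ball_mem_nhds (0 : E) one_pos] with y hy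
        rw [mem_ball_zero_iff] at hy
        rw [norm_pow, norm_pow, norm_norm, one_mul]
        exact pow_le_pow_of_le_one (norm_nonneg _) hy.le hkm
      refine ((hO.trans h1).sub (hp.isBigO_sub_partialSum_pow (k + 1))).congr_left fun y => ?_
      rw [FormalMultilinearSeries.partialSum, Finset.sum_range_succ,
        Finset.sum_eq_single_of_mem 0 (Finset.mem_range.mpr hk), hp.coeff_zero]
      · abel
      · intro j hj hj0
        have hj := Finset.mem_range.mp hj
        exact ih j hj (by omega) (by omega) y
  refine ⟨⟨hm, fun h0 => ?_⟩, fun k hk => ?_⟩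
  · have h1 := isBigO_sub_of_forall_eq_zero hp (k := m + 1) fun j hj hjm => by
      rcases Nat.lt_succ_iff_lt_or_eq.mp hjm with h | rfl
      · exact hlow j hj h
      · exact (iteratedFDeriv_eq_zero_iff hp _).mp h0
    have h2 : (fun y : E => ‖y‖ ^ (m + 1)) =o[𝓝 0] fun y => ‖y‖ ^ m :=
      isLittleO_norm_pow_norm_pow (Nat.lt_succ_self m)
    have h3 := (hΩ.trans h1).trans_isLittleO h2
    refine isLittleO_irrefl ?_ h3
    have : ∃ᶠ y in 𝓝[≠] (0 : E), y ≠ 0 := by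
      refine Eventually.frequently ?_
      filter_upwards [self_mem_nhdsWithin] with y hy using hy
    exact (this.filter_mono nhdsWithin_le_nhds).mono fun y hy =>
      pow_ne_zero _ (norm_ne_zero_iff.mpr hy)
  · by_contra hlt
    exact hk.2 ((iteratedFDeriv_eq_zero_iff hp k).mpr (hlow k hk.1 (not_le.mp hlt)))

end Multiplicity

end EllipticScheme

/-! ### Estimates uniform in the lattice -/

namespace PeriodPair

/-- `HasGap L c` says that the real combination `x ω₁ + y ω₂` has absolute value at least
`c * max |x| |y|`. -/
def HasGap (L : PeriodPair) (c : ℝ) : Prop :=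
  ∀ x y : ℝ, c * max |x| |y| ≤ ‖(x * L.ω₁ + y * L.ω₂ : ℂ)‖

/-- The real-linear isomorphism `ℝ² → ℂ` given by the periods is bounded below. -/
lemma exists_hasGap (L : PeriodPair) : ∃ c > 0, L.HasGap c := by
  let f : ℝ × ℝ →ₗ[ℝ] ℂ :=
    (LinearMap.fst ℝ ℝ ℝ).smulRight L.ω₁ + (LinearMap.snd ℝ ℝ ℝ).smulRight L.ω₂
  have hf : LinearMap.ker f = ⊥ := by
    rw [LinearMap.ker_eq_bot']
    rintro ⟨x, y⟩ h
    have := LinearIndependent.pair_iff.mp L.indep x y (by simpa [f] using h)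
    exact Prod.ext this.1 this.2
  obtain ⟨K, hK, hanti⟩ := f.exists_antilipschitzWith hf
  have hK' : (0 : ℝ) < K := hK
  refine ⟨(K : ℝ)⁻¹, inv_pos.mpr hK', fun x y => ?_⟩
  have := hanti.le_mul_dist (x, y) 0
  rw [map_zero, dist_zero_right, dist_zero_right, Prod.norm_def] at this
  rw [inv_mul_le_iff₀ hK']
  simpa [f] using this

/-- The gap condition is stable under small perturbations of the periods. -/
lemma HasGap.perturb {L L' : PeriodPair} {c : ℝ} (h : L.HasGap c)
    (h₁ : ‖L'.ω₁ - L.ω₁‖ ≤ c / 4) (h₂ : ‖L'.ω₂ - L.ω₂‖ ≤ c / 4) : L'.HasGap (c / 2) := by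
  intro x y
  have h0 := h x y
  have e : (x * L.ω₁ + y * L.ω₂ : ℂ) =
      (x * L'.ω₁ + y * L'.ω₂) - (x * (L'.ω₁ - L.ω₁) + y * (L'.ω₂ - L.ω₂)) := by ring
  have hx : ‖(x : ℂ) * (L'.ω₁ - L.ω₁)‖ ≤ max |x| |y| * (c / 4) := by
    rw [norm_mul, Complex.norm_real]
    exact mul_le_mul (le_max_left _ _) h₁ (norm_nonneg _) (le_max_of_le_left (abs_nonneg _))
  have hy : ‖(y : ℂ) * (L'.ω₂ - L.ω₂)‖ ≤ max |x| |y| * (c / 4) := by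
    rw [norm_mul, Complex.norm_real]
    exact mul_le_mul (le_max_right _ _) h₂ (norm_nonneg _) (le_max_of_le_left (abs_nonneg _))
  have h3 := norm_sub_le (x * L'.ω₁ + y * L'.ω₂ : ℂ)
    (x * (L'.ω₁ - L.ω₁) + y * (L'.ω₂ - L.ω₂))
  have h4 := norm_add_le ((x : ℂ) * (L'.ω₁ - L.ω₁)) (y * (L'.ω₂ - L.ω₂))
  rw [← e] at h3
  linarith

lemma norm_combination_le (L : PeriodPair) (x y : ℝ) :
    ‖(x * L.ω₁ + y * L.ω₂ : ℂ)‖ ≤ max |x| |y| * (‖L.ω₁‖ + ‖L.ω₂‖) := by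
  refine (norm_add_le _ _).trans ?_
  rw [norm_mul, norm_mul, Complex.norm_real, Complex.norm_real, mul_add]
  exact add_le_add (mul_le_mul_of_nonneg_right (le_max_left _ _) (norm_nonneg _))
    (mul_le_mul_of_nonneg_right (le_max_right _ _) (norm_nonneg _))

/-- The integer coordinates of a lattice vector. -/
def latticeCoords (L : PeriodPair) : L.lattice ≃ (Fin 2 → ℤ) :=
  L.latticeEquivProd.toEquiv.trans (finTwoArrowEquiv ℤ).symm

lemma HasGap.mul_norm_latticeCoords_le {L : PeriodPair} {c : ℝ} (h : L.HasGap c)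
    (l : L.lattice) : c * ‖L.latticeCoords l‖ ≤ ‖(l : ℂ)‖ := by
  obtain ⟨x, rfl⟩ := L.latticeEquivProd.symm.surjective l
  have := h x.1 x.2
  rw [L.latticeEquiv_symm_apply]
  refine le_trans (le_of_eq ?_) (this.trans_eq (by push_cast; rfl))
  congr 1
  simp [latticeCoords, Pi.norm_def, Fin.univ_succ, Int.norm_eq_abs]

lemma one_le_norm_latticeCoords {L : PeriodPair} {l : L.lattice} (hl : l ≠ 0) :
    1 ≤ ‖L.latticeCoords l‖ := by
  have h0 : L.latticeCoords l ≠ 0 := by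
    intro h
    apply hl
    have h2 : L.latticeCoords 0 = 0 := by
      ext i; fin_cases i <;> simp [latticeCoords]
    exact L.latticeCoords.injective (h.trans h2.symm)
  obtain ⟨i, hi⟩ := Function.ne_iff.mp h0
  refine le_trans ?_ (norm_le_pi_norm _ i)
  rw [Int.norm_eq_abs]
  exact_mod_cast Int.one_le_abs hi

lemma HasGap.le_norm {L : PeriodPair} {c : ℝ} (hc : 0 < c) (h : L.HasGap c) {l : L.lattice}
    (hl : l ≠ 0) : c ≤ ‖(l : ℂ)‖ :=
  le_trans (le_mul_of_one_le_right hc.le (one_le_norm_latticeCoords hl))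
    (h.mul_norm_latticeCoords_le l)

lemma HasGap.notMem_lattice {L : PeriodPair} {c : ℝ} (hc : 0 < c) (h : L.HasGap c) {s : ℂ}
    (hs0 : s ≠ 0) (hs : ‖s‖ < c) : s ∉ L.lattice := fun hmem =>
  (h.le_norm hc (l := ⟨s, hmem⟩) (fun h => hs0 (congrArg Subtype.val h))).not_gt hs

/-- The principal parts of `℘` and `℘'` at `0`, with an error which is uniform in the lattice. -/
lemma exists_weierstrassP_sub_le {c : ℝ} (hc : 0 < c) : ∃ A : ℝ, 0 ≤ A ∧ ∀ L : PeriodPair,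
    L.HasGap c → ∀ s : ℂ, ‖s‖ < c / 2 → ‖L.weierstrassP s - 1 / s ^ 2‖ ≤ A ∧
      ‖L.derivWeierstrassP s + 2 / s ^ 3‖ ≤ A := by
  have hsum := EisensteinSeries.summable_one_div_norm_rpow (k := 3) (by norm_num)
  set S := ∑' x : Fin 2 → ℤ, ‖x‖ ^ (-3 : ℝ) with hS
  have hS0 : 0 ≤ S := tsum_nonneg fun x => Real.rpow_nonneg (norm_nonneg _) _
  have hc3 : 0 ≤ c ^ (-3 : ℝ) := Real.rpow_nonneg hc.le _
  set M := max (10 * (c / 2)) 16 with hM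
  have hM0 : 0 ≤ M := le_max_of_le_right (by norm_num)
  refine ⟨M * c ^ (-3 : ℝ) * S, by positivity, fun L hL s hs => ?_⟩
  have hhas : HasSum (fun l : L.lattice => M * c ^ (-3 : ℝ) * ‖L.latticeCoords l‖ ^ (-3 : ℝ))
      (M * c ^ (-3 : ℝ) * S) :=
    ((L.latticeCoords.hasSum_iff (f := fun x => ‖x‖ ^ (-3 : ℝ))).mpr hsum.hasSum).mul_left _
  have hle : ∀ l : L.lattice, l ≠ 0 →
      ‖(l : ℂ)‖ ^ (-3 : ℝ) ≤ c ^ (-3 : ℝ) * ‖L.latticeCoords l‖ ^ (-3 : ℝ) := by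
    intro l hl
    have h1 := one_le_norm_latticeCoords hl
    rw [← Real.mul_rpow hc.le (norm_nonneg _)]
    exact Real.rpow_le_rpow_of_nonpos (by positivity) (hL.mul_norm_latticeCoords_le l)
      (by norm_num)
  have hbound : ∀ l : L.lattice, l ≠ 0 → ∀ z : ℂ, ‖z‖ ≤ M * ‖(l : ℂ)‖ ^ (-3 : ℝ) →
      ‖z‖ ≤ M * c ^ (-3 : ℝ) * ‖L.latticeCoords l‖ ^ (-3 : ℝ) := fun l hl z hz => by
    refine hz.trans ?_
    rw [mul_assoc]
    exact mul_le_mul_of_nonneg_left (hle l hl) hM0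
  have hnn : ∀ l : L.lattice, 0 ≤ M * c ^ (-3 : ℝ) * ‖L.latticeCoords l‖ ^ (-3 : ℝ) :=
    fun l => by positivity
  constructor
  · have h1 := L.weierstrassPExcept_add 0 s
    simp only [ZeroMemClass.coe_zero, sub_zero, ne_eq, OfNat.ofNat_ne_zero, not_false_eq_true,
      zero_pow, div_zero] at h1
    rw [← h1, add_sub_cancel_right, weierstrassPExcept]
    refine tsum_of_norm_bounded hhas fun l => ?_
    split_ifs with hl
    · simpa using hnn l
    · have hl' : l ≠ 0 := fun h => hl (by simp [h])
      refine hbound l hl' _ ((weierstrassP_bound (c / 2) (by positivity) s hs l ?_).trans ?_)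
      · have := hL.le_norm hc hl'
        linarith
      · exact mul_le_mul_of_nonneg_right (le_max_left _ _) (Real.rpow_nonneg (norm_nonneg _) _)
  · have h1 := L.derivWeierstrassPExcept_sub 0 s
    simp only [ZeroMemClass.coe_zero, sub_zero] at h1
    rw [← h1, sub_add_cancel, derivWeierstrassPExcept]
    refine tsum_of_norm_bounded hhas fun l => ?_
    split_ifs with hl
    · simpa using hnn l
    · have hl' : l ≠ 0 := fun h => hl (by simp [h])
      refine hbound l hl' _ (le_trans ?_ (mul_le_mul_of_nonneg_right (le_max_right _ _)
        (Real.rpow_nonneg (norm_nonneg _) _)))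
      have h2 := hL.le_norm hc hl'
      have h3 : ‖(l : ℂ)‖ / 2 ≤ ‖s - l‖ := by
        have := norm_sub_norm_le (l : ℂ) s
        rw [norm_sub_rev] at this
        linarith
      have h4 : 0 < ‖(l : ℂ)‖ := hc.trans_le h2
      rw [Real.rpow_neg h4.le, norm_div, norm_neg, norm_pow, Complex.norm_ofNat,
        show (3 : ℝ) = ((3 : ℕ) : ℝ) by norm_num, Real.rpow_natCast]
      calc 2 / ‖s - l‖ ^ 3 ≤ 2 / (‖(l : ℂ)‖ / 2) ^ 3 := by gcongr
        _ = 16 * (‖(l : ℂ)‖ ^ 3)⁻¹ := by field_simp; norm_num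

end PeriodPair

/-! ### The multiplicity of the Betti map -/

namespace EllipticScheme

open Filter Topology Asymptotics

section ValueAt

variable {R K : Type*} [CommRing R] [Algebra ℂ R] [Field K] [Algebra R K]
  [IsFractionRing R K] {W : WeierstrassCurve R} {σ : (W.map (algebraMap R K)).toAffine.Point}

/-- The value of a section at a point of the base is unique. -/
lemma IsValueAt.unique {b : R →ₐ[ℂ] ℂ} {P Q : (fibre W b).toAffine.Point}
    (hP : IsValueAt W σ b P) (hQ : IsValueAt W σ b Q) : P = Q := by
  obtain ⟨v, hv, hvP⟩ := hP
  obtain ⟨w, hw, hwQ⟩ := hQ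
  have hvP' : IsRep (b ∘ v) P := hvP
  have hwQ' : IsRep (b ∘ w) Q := hwQ
  refine hvP'.eq_of_cross hwQ' fun i j => ?_
  have h : v i * w j = v j * w i := by
    apply IsFractionRing.injective R K
    have := IsRep.cross (v := algebraMap R K ∘ v) (w := algebraMap R K ∘ w) hv hw i j
    simpa using this
  simpa using congrArg b h

lemma IsValueAt.nsmul_eq_zero {b b' : R →ₐ[ℂ] ℂ} (h : b' = b) {P : (fibre W b).toAffine.Point}
    {P' : (fibre W b').toAffine.Point} (hP : IsValueAt W σ b P) (hP' : IsValueAt W σ b' P')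
    {n : ℕ} (hn : n • P = 0) : n • P' = 0 := by
  subst h
  rwa [hP'.unique hP]

end ValueAt

/-- Near the origin the function `X / Y` inverts the elliptic exponential up to sign and up to
second order, uniformly in the curve. -/
lemma exists_norm_coords_div_add_le {c M : ℝ} (hc : 0 < c) (hM : 0 ≤ M) :
    ∃ r C : ℝ, 0 < r ∧ 0 ≤ C ∧ ∀ (W : WeierstrassCurve ℂ) [W.IsElliptic] (L : PeriodPair)
      (hL : IsPeriodPairOf W L), L.HasGap c → ‖W.b₂‖ ≤ M → ‖W.a₁‖ ≤ M → ‖W.a₃‖ ≤ M →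
      ∀ s : ℂ, ‖s‖ < r →
        ‖coords (ellipticExp W L hL s) 0 / coords (ellipticExp W L hL s) 1 + s‖ ≤
          C * ‖s‖ ^ 2 := by
  obtain ⟨A, hA, h⟩ := PeriodPair.exists_weierstrassP_sub_le hc
  set B := A + M + M * (1 + A + M) with hB
  have hB0 : 0 ≤ B := by positivity
  refine ⟨min (c / 2) (min 1 (1 / (2 * (B + 1)))), 4 * B, by positivity, by positivity, ?_⟩
  intro W _ L hL hgap hb₂ ha₁ ha₃ s hs
  obtain ⟨hs1, hs2, hs3⟩ : ‖s‖ < c / 2 ∧ ‖s‖ < 1 ∧ ‖s‖ < 1 / (2 * (B + 1)) := by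
    simpa [lt_min_iff] using hs
  by_cases hs0 : s = 0
  · subst hs0
    rw [ellipticExp_of_mem hL (zero_mem _)]
    simp [coords]
  have hmem : s ∉ L.lattice := hgap.notMem_lattice hc hs0 (by linarith)
  obtain ⟨h1, h2⟩ := h L hgap s hs1
  have hn0 := norm_nonneg s
  rw [ellipticExp, dif_neg hmem]
  change ‖(L.weierstrassP s - W.b₂ / 12) / ((L.derivWeierstrassP s -
    W.a₁ * (L.weierstrassP s - W.b₂ / 12) - W.a₃) / 2) + s‖ ≤ _
  set D := L.weierstrassP s - 1 / s ^ 2 with hD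
  set D' := L.derivWeierstrassP s + 2 / s ^ 3 with hD'
  -- `e₁` and `e₂` are the relative errors of `x = s⁻² (1 + e₁)` and `y = -s⁻³ (1 + e₂)`.
  set e₁ := s * (s * (D - W.b₂ / 12)) with he₁
  set e₂ := s * (-(s ^ 2 * D') / 2 + W.a₁ * (1 + e₁) / 2 + s ^ 2 * W.a₃ / 2) with he₂
  have hx : L.weierstrassP s - W.b₂ / 12 = (1 + e₁) / s ^ 2 := by
    rw [he₁, hD]; field_simp; ring
  have hy : (L.derivWeierstrassP s - W.a₁ * (L.weierstrassP s - W.b₂ / 12) - W.a₃) / 2 =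
      -(1 + e₂) / s ^ 3 := by
    rw [hx, he₂, hD']; field_simp; ring
  have hsq : ‖s ^ 2‖ ≤ 1 := by rw [norm_pow]; exact pow_le_one₀ hn0 hs2.le
  have hb12 : ‖W.b₂ / 12‖ ≤ M := by
    rw [norm_div, Complex.norm_ofNat]; linarith [norm_nonneg W.b₂]
  have hn1 : ‖s * (D - W.b₂ / 12)‖ ≤ A + M := by
    rw [norm_mul]
    have := norm_sub_le D (W.b₂ / 12)
    exact (mul_le_of_le_one_left (norm_nonneg _) hs2.le).trans (by linarith)
  have hE1' : ‖e₁‖ ≤ ‖s‖ * (A + M) := by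
    rw [he₁, norm_mul]; exact mul_le_mul_of_nonneg_left hn1 hn0
  have hE1 : ‖e₁‖ ≤ ‖s‖ * B :=
    hE1'.trans (mul_le_mul_of_nonneg_left (by rw [hB]; nlinarith) hn0)
  have hE1'' : ‖1 + e₁‖ ≤ 1 + A + M := by
    refine (norm_add_le _ _).trans ?_
    rw [norm_one]
    have : ‖s‖ * (A + M) ≤ A + M := mul_le_of_le_one_left (by positivity) hs2.le
    linarith
  have hE2 : ‖e₂‖ ≤ ‖s‖ * B := by
    rw [he₂, norm_mul]
    refine mul_le_mul_of_nonneg_left ?_ hn0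
    have t1 : ‖-(s ^ 2 * D') / 2‖ ≤ A := by
      rw [norm_div, norm_neg, norm_mul, Complex.norm_ofNat]
      have := mul_le_of_le_one_left (norm_nonneg D') hsq
      linarith [norm_nonneg D']
    have t2 : ‖W.a₁ * (1 + e₁) / 2‖ ≤ M * (1 + A + M) := by
      rw [norm_div, norm_mul, Complex.norm_ofNat]
      have := mul_le_mul ha₁ hE1'' (norm_nonneg _) hM
      linarith [mul_nonneg (norm_nonneg W.a₁) (norm_nonneg (1 + e₁))]
    have t3 : ‖s ^ 2 * W.a₃ / 2‖ ≤ M := by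
      rw [norm_div, norm_mul, Complex.norm_ofNat]
      have := mul_le_of_le_one_left (norm_nonneg W.a₃) hsq
      linarith [norm_nonneg W.a₃]
    exact (norm_add₃_le).trans (by rw [hB]; linarith)
  have hhalf : ‖s‖ * B ≤ 1 / 2 := by
    rw [lt_div_iff₀ (by positivity)] at hs3
    nlinarith
  have hden : 1 / 2 ≤ ‖1 + e₂‖ := by
    have := norm_sub_norm_le (1 : ℂ) (-e₂)
    rw [norm_one, norm_neg, sub_neg_eq_add] at this
    linarith
  have hne : 1 + e₂ ≠ 0 := norm_pos_iff.mp (by linarith)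
  have e : (L.weierstrassP s - W.b₂ / 12) / ((L.derivWeierstrassP s -
      W.a₁ * (L.weierstrassP s - W.b₂ / 12) - W.a₃) / 2) + s = s * (e₂ - e₁) / (1 + e₂) := by
    rw [hy, hx]; field_simp; ring
  rw [e, norm_div, norm_mul, div_le_iff₀ (by linarith)]
  have h3 : ‖e₂ - e₁‖ ≤ 2 * (‖s‖ * B) := (norm_sub_le _ _).trans (by linarith)
  calc ‖s‖ * ‖e₂ - e₁‖ ≤ ‖s‖ * (2 * (‖s‖ * B)) := mul_le_mul_of_nonneg_left h3 hn0
    _ = 4 * B * ‖s‖ ^ 2 * (1 / 2) := by ring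
    _ ≤ 4 * B * ‖s‖ ^ 2 * ‖1 + e₂‖ := mul_le_mul_of_nonneg_left hden (by positivity)

section Betti

variable {R : Type*} [CommRing R] [Algebra ℂ R] {b : R →ₐ[ℂ] ℂ}

lemma LocalCoordinate.differentiableAt (D : LocalCoordinate b) (f : R) :
    DifferentiableAt ℂ (fun u => D.φ u f) 0 :=
  (D.holomorphic f).differentiableAt (D.isOpen.mem_nhds D.zero_mem)

/-- A local parameter of the curve at `b` vanishes to first order in a local coordinate. -/
lemma LocalCoordinate.isTheta_parameter (D : LocalCoordinate b) {t : R} (ht : b t = 0)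
    (hgen : ∀ x, b x = 0 → ∃ y q, b q ≠ 0 ∧ q * x = t * y) :
    (fun u => D.φ u t) =Θ[𝓝 0] fun u => u := by
  obtain ⟨f, hf⟩ := D.immersion 0 D.zero_mem
  obtain ⟨y, q, hq, hxy⟩ := hgen (f - algebraMap ℂ R (b f)) (by simp)
  have hφ : ∀ g, HasDerivAt (fun u => D.φ u g) (deriv (fun u => D.φ u g) 0) 0 := fun g =>
    (D.differentiableAt g).hasDerivAt
  have hd : deriv (fun u => D.φ u t) 0 ≠ 0 := by
    intro h0
    have h1 := (hφ q).mul ((hφ f).sub_const (b f))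
    have h2 := (hφ t).mul (hφ y)
    have he : (fun u => D.φ u q) * (fun u => D.φ u f - b f) =
        (fun u => D.φ u t) * fun u => D.φ u y := by
      funext u
      simpa using congrArg (D.φ u) hxy
    rw [he] at h1
    have h3 := h1.unique h2
    simp only [D.map_zero, ht, h0, sub_self, mul_zero, zero_add, zero_mul, add_zero] at h3
    exact mul_ne_zero hq hf h3
  have := HasDerivAtFilter.isTheta_sub (hφ t) hd
  have hk : Tendsto (fun u : ℂ => (u, (0 : ℂ))) (𝓝 0) (𝓝 0 ×ˢ pure 0) :=
    tendsto_id.prodMk (tendsto_pure.mpr (Eventually.of_forall fun _ => rfl))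
  have h1 := this.1.comp_tendsto hk
  have h2 := this.2.comp_tendsto hk
  simp only [Function.comp_def, D.map_zero, ht, sub_zero] at h1 h2
  exact ⟨h1, h2⟩

/-- If the value at `b` of the section is `n`-torsion and `X / Y` of the `n`-th multiple of the
section vanishes at `b` to order `m`, then `m` is the multiplicity of every determination of the
Betti map. -/
lemma isMultiplicity_of_coords {K : Type*} [Field K] [Algebra R K] {W : WeierstrassCurve R}
    [W.IsElliptic] {σ : (W.map (algebraMap R K)).toAffine.Point} {D : LocalCoordinate b}
    {ρ : PeriodChoice W D} {β : ℂ → ℝ × ℝ} (hβ : IsBettiMap W σ ρ β) {n m : ℕ} (hn : 0 < n)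
    (hm : 1 ≤ m)
    (hzero : ∀ P' : (fibre W (D.φ 0)).toAffine.Point, IsValueAt W σ (D.φ 0) P' → n • P' = 0)
    {t r s : R} (ht : b t = 0) (hr : b r ≠ 0) (hs : b s ≠ 0)
    (hgen : ∀ x, b x = 0 → ∃ y q, b q ≠ 0 ∧ q * x = t * y)
    (hval : ∀ (b' : R →ₐ[ℂ] ℂ) (P' : (fibre W b').toAffine.Point), IsValueAt W σ b' P' →
      b' s ≠ 0 → coords (n • P') 0 / coords (n • P') 1 = b' t ^ m * b' r / b' s) :
    IsMultiplicity β 0 m := by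
  obtain ⟨hana, hlog⟩ := hβ
  have hU : D.U ∈ 𝓝 (0 : ℂ) := D.isOpen.mem_nhds D.zero_mem
  have hω₁ : ContinuousAt (fun u => (ρ.L u).ω₁) 0 :=
    (ρ.holomorphic₁.differentiableAt hU).continuousAt
  have hω₂ : ContinuousAt (fun u => (ρ.L u).ω₂) 0 :=
    (ρ.holomorphic₂.differentiableAt hU).continuousAt
  have hφ : ∀ g, ContinuousAt (fun u => D.φ u g) 0 := fun g => (D.differentiableAt g).continuousAt
  have hβ0 : ContinuousAt β 0 := (hana 0 D.zero_mem).continuousAt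
  -- The period lattices of the fibres near `b` are uniformly nondegenerate.
  obtain ⟨c, hc, hgap⟩ := (ρ.L 0).exists_hasGap
  have hgap' : ∀ᶠ u in 𝓝 0, (ρ.L u).HasGap (c / 2) := by
    have h1 := Metric.continuousAt_iff'.mp hω₁ (c / 4) (by positivity)
    have h2 := Metric.continuousAt_iff'.mp hω₂ (c / 4) (by positivity)
    filter_upwards [h1, h2] with u h1 h2
    rw [dist_eq_norm] at h1 h2
    exact hgap.perturb h1.le h2.le
  -- The integral coordinates of `n` times the elliptic logarithm at `0`.
  have hlog0 := hzero _ (hlog 0 D.zero_mem)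
  rw [nsmul_ellipticExp, ellipticExp_eq_zero_iff, PeriodPair.mem_lattice] at hlog0
  obtain ⟨k, l, hkl⟩ := hlog0
  have hk : (n : ℝ) * (β 0).1 = k ∧ (n : ℝ) * (β 0).2 = l := by
    have h0 := LinearIndependent.pair_iff.mp (ρ.L 0).indep (n * (β 0).1 - k) (n * (β 0).2 - l) (by
      simp only [Complex.real_smul]
      push_cast
      linear_combination -hkl)
    exact ⟨by linarith [h0.1], by linarith [h0.2]⟩
  -- `S u` is a logarithm of `n σ (u)` which tends to `0`.
  set S : ℂ → ℂ := fun u => ((n * ((β u).1 - (β 0).1) : ℝ) : ℂ) * (ρ.L u).ω₁ +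
    ((n * ((β u).2 - (β 0).2) : ℝ) : ℂ) * (ρ.L u).ω₂ with hS
  have hexp : ∀ u (hu : u ∈ D.U), n • ellipticExp (fibre W (D.φ u)) (ρ.L u) (ρ.isPeriodPair u hu)
      ((β u).1 * (ρ.L u).ω₁ + (β u).2 * (ρ.L u).ω₂) =
      ellipticExp (fibre W (D.φ u)) (ρ.L u) (ρ.isPeriodPair u hu) (S u) := by
    intro u hu
    rw [nsmul_ellipticExp, ← ellipticExp_add_of_mem _ (S u)
      (PeriodPair.mem_lattice.mpr ⟨k, l, rfl⟩ : (k * (ρ.L u).ω₁ + l * (ρ.L u).ω₂) ∈ _)]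
    congr 1
    have h1 : ((k : ℤ) : ℂ) = n * (β 0).1 := by exact_mod_cast hk.1.symm
    have h2 : ((l : ℤ) : ℂ) = n * (β 0).2 := by exact_mod_cast hk.2.symm
    rw [h1, h2, hS]
    push_cast
    ring
  have hS0 : Tendsto S (𝓝 0) (𝓝 0) := by
    have hc1 : ContinuousAt S 0 := by
      have h1 : ContinuousAt (fun u => ((n * ((β u).1 - (β 0).1) : ℝ) : ℂ)) 0 := by fun_prop
      have h2 : ContinuousAt (fun u => ((n * ((β u).2 - (β 0).2) : ℝ) : ℂ)) 0 := by fun_prop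
      exact (h1.mul hω₁).add (h2.mul hω₂)
    have h0 : S 0 = 0 := by simp [hS]
    simpa [ContinuousAt, h0] using hc1
  -- `S` has the same growth as the difference of the values of the Betti map.
  have hΘ₁ : S =Θ[𝓝 0] fun u => β u - β 0 := by
    have hnorm : ∀ u, max |n * ((β u).1 - (β 0).1)| |n * ((β u).2 - (β 0).2)| =
        n * ‖β u - β 0‖ := by
      intro u
      rw [abs_mul, abs_mul, Nat.abs_cast, ← mul_max_of_nonneg _ _ (Nat.cast_nonneg n)]
      rfl
    constructor
    · refine IsBigO.of_bound (n * (‖(ρ.L 0).ω₁‖ + ‖(ρ.L 0).ω₂‖ + 1)) ?_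
      have := (hω₁.norm.add hω₂.norm).eventually_lt_const (lt_add_one _)
      filter_upwards [this] with u hu
      refine ((ρ.L u).norm_combination_le _ _).trans ?_
      rw [hnorm]
      calc _ ≤ n * ‖β u - β 0‖ * (‖(ρ.L 0).ω₁‖ + ‖(ρ.L 0).ω₂‖ + 1) :=
            mul_le_mul_of_nonneg_left hu.le (by positivity)
        _ = _ := by ring
    · refine IsBigO.of_bound (c / 2 * n)⁻¹ ?_
      filter_upwards [hgap'] with u hu
      have := hu (n * ((β u).1 - (β 0).1)) (n * ((β u).2 - (β 0).2))
      rw [hnorm, ← mul_assoc] at this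
      rw [← div_eq_inv_mul, le_div_iff₀' (by positivity)]
      exact this
  -- `h` is the function `X / Y` of `n σ`; it agrees with `-S` to first order.
  set h : ℂ → ℂ := fun u => D.φ u t ^ m * D.φ u r / D.φ u s with hh
  have hsmall : (fun u => h u + S u) =o[𝓝 0] S := by
    set M := ‖(fibre W (D.φ 0)).b₂‖ + ‖(fibre W (D.φ 0)).a₁‖ + ‖(fibre W (D.φ 0)).a₃‖ + 1 with hM
    obtain ⟨r₀, C, hr₀, hC, hest⟩ := exists_norm_coords_div_add_le (c := c / 2) (M := M)
      (by positivity) (by positivity)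
    have hO : (fun u => h u + S u) =O[𝓝 0] fun u => S u ^ 2 := by
      refine IsBigO.of_bound C ?_
      have hb₂ : ContinuousAt (fun u => (fibre W (D.φ u)).b₂) 0 := by
        simp only [fibre, WeierstrassCurve.map_b₂]
        exact hφ W.b₂
      have ha₁ : ContinuousAt (fun u => (fibre W (D.φ u)).a₁) 0 := hφ W.a₁
      have ha₃ : ContinuousAt (fun u => (fibre W (D.φ u)).a₃) 0 := hφ W.a₃
      have hsne : ∀ᶠ u in 𝓝 0, D.φ u s ≠ 0 :=
        (hφ s).eventually_ne (by rwa [D.map_zero])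
      filter_upwards [hU, hgap', hsne, hb₂.norm.eventually_lt_const (lt_add_one _),
        ha₁.norm.eventually_lt_const (lt_add_one _), ha₃.norm.eventually_lt_const (lt_add_one _),
        hS0.norm.eventually_lt_const (by simpa using hr₀)] with u hu hg hsu h1 h2 h3 h4
      have hv := hval _ _ (hlog u hu) hsu
      rw [hexp u hu] at hv
      have n1 := norm_nonneg (fibre W (D.φ 0)).a₁
      have n2 := norm_nonneg (fibre W (D.φ 0)).b₂
      have n3 := norm_nonneg (fibre W (D.φ 0)).a₃
      have := hest (fibre W (D.φ u)) (ρ.L u) (ρ.isPeriodPair u hu) hg (h1.le.trans (by linarith))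
        (h2.le.trans (by linarith)) (h3.le.trans (by linarith)) (S u) h4
      rw [hv] at this
      rwa [norm_pow]
    refine hO.trans_isLittleO ?_
    have h1 : S =o[𝓝 0] fun _ => (1 : ℂ) := (isLittleO_one_iff ℂ).mpr hS0
    have := h1.mul_isBigO (isBigO_refl S (𝓝 0))
    simpa [pow_two] using this
  have hΘ₂ : S =Θ[𝓝 0] h := by
    have h1 := (hsmall.neg_left).right_isTheta_add'
    have h2 : (S + fun u => -(h u + S u)) = fun u => -h u := by
      funext u; simp
    rw [h2] at h1
    exact h1.trans (IsTheta.of_norm_eventuallyEq_norm (Eventually.of_forall fun u => norm_neg _))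
  have hΘ₃ : h =Θ[𝓝 0] fun u : ℂ => ‖u‖ ^ m := by
    have h1 : (fun u => D.φ u r / D.φ u s) =Θ[𝓝 0] fun _ => (1 : ℂ) := by
      have hr' : D.φ 0 r ≠ 0 := by rwa [D.map_zero]
      have hs' : D.φ 0 s ≠ 0 := by rwa [D.map_zero]
      constructor
      · exact ((hφ r).div (hφ s) hs').tendsto.isBigO_one ℂ
      · have h2 : (fun u => D.φ u s / D.φ u r) =O[𝓝 0] fun _ => (1 : ℂ) :=
          ((hφ s).div (hφ r) hr').tendsto.isBigO_one ℂ
        refine ((isBigO_refl (fun u => D.φ u r / D.φ u s) _).mul h2).congr' ?_ ?_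
        · filter_upwards [(hφ r).eventually_ne hr', (hφ s).eventually_ne hs'] with u h3 h4
          field_simp
        · exact Eventually.of_forall fun u => mul_one _
    have h2 := ((D.isTheta_parameter ht hgen).pow m).mul h1
    have h3 : (fun u : ℂ => u ^ m * 1) =Θ[𝓝 0] fun u : ℂ => ‖u‖ ^ m :=
      IsTheta.of_norm_eventuallyEq_norm (Eventually.of_forall fun u => by simp)
    refine IsTheta.trans ?_ h3
    simpa only [hh, mul_div_assoc] using h2
  have hΘ := (hΘ₁.symm.trans hΘ₂).trans hΘ₃
  exact isLeast_iteratedFDeriv_ne_zero (hana 0 D.zero_mem) hm (by simpa using hΘ.1)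
    (by simpa using hΘ.2)

end Betti

end EllipticScheme

end

theorem mainTheorem7 {R K : Type*} [CommRing R] [IsDedekindDomain R] [Algebra ℂ R]
    [Algebra.FiniteType ℂ R] (hR : ¬ IsField R)
    [Field K] [DecidableEq K] [Algebra R K] [IsFractionRing R K]
    (W : WeierstrassCurve R) [W.IsElliptic]
    (σ : (W.map (algebraMap R K)).toAffine.Point) (hσ : ∀ n : ℕ, 0 < n → n • σ ≠ 0)
    (b : R →ₐ[ℂ] ℂ) (P : (EllipticScheme.fibre W b).toAffine.Point)
    (hP : EllipticScheme.IsValueAt W σ b P) (htors : ∃ n : ℕ, 0 < n ∧ n • P = 0) :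
    ∃ m : ℕ,
      (∀ n : ℕ, 0 < n → n • P = 0 → EllipticScheme.torsionIntersection W P σ n = m) ∧
      (∀ (D : EllipticScheme.LocalCoordinate b) (ρ : EllipticScheme.PeriodChoice W D)
        (β : ℂ → ℝ × ℝ), EllipticScheme.IsBettiMap W σ ρ β →
          EllipticScheme.IsMultiplicity β 0 m) := by
  obtain ⟨m, h1, hm, n, hn, hnP, t, r, s, ht, hr, hs, hgen, hval⟩ :=
    EllipticScheme.exists_multiplicity hR hσ hP htors
  refine ⟨m, h1, fun D ρ β hβ => ?_⟩
  exact EllipticScheme.isMultiplicity_of_coords hβ hn hm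
    (fun P' hP' => hP.nsmul_eq_zero D.map_zero hP' hnP) ht hr hs hgen hval
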